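/- **Setting.** Let $K\in\mathbb{R}^{m\times n}$, let $f:\mathbb{R}^n\to(-\infty,+\infty]$ and $g:\mathbb{R}^m\to(-\infty,+\infty]$ be proper closed convex functions, let $g^*$ be the convex conjugate of $g$, and let $$\mathcal{L}(x,y)=f(x)+\langle Kx,y\rangle-g^*(y).$$ Assume that $\mathcal L$ has a saddle point, i.e. a pair $(x^\star,y^\star)$ with $\mathcal L(x^\star,y)\le\mathcal L(x^\star,y^\star)\le\mathcal L(x,y^\star)$ for all $x,y$. Let $\Sigma_f\in\mathbb{R}^{n\times n}$ be a symmetric positive semidefinite matrix such that $\langle\xi_1-\xi_2,x_1-x_2\rangle\ge\|x_1-x_2\|_{\Sigma_f}^2$ for all $x_1,x_2$ and all $\xi_1\in\partial f(x_1)$, $\xi_2\in\partial f(x_2)$, where $\|z\|_M^2:=\langle z,Mz\rangle$ for symmetric $M$. Let $M_1\in\mathbb{R}^{n\times n}$ and $M_2\in\mathbb{R}^{m\times m}$ be symmetric. Let $\{(x^k,y^k)\}_{k\ge0}$ be an infinite sequence, with arbitrary initial point $(x^0,y^0)$, generated for $k\ge 0$ by $$x^{k+1}=\operatorname*{argmin}_{x}\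 f(x)+\langle Kx,y^k\rangle+\tfrac12\|x-x^k\|_{M_1}^2,\qquad y^{k+1}=\operatorname*{argmin}_{y}\ g^*(y)-\langle K(2x^{k+1}-x^k),y\rangle+\tfrac12\|y-y^k\|_{M_2}^2 .$$ Below, $\|\cdot\|$ is the Euclidean norm of vectors and the spectral norm of matrices, and $M^{-1/2}$ is the positive definite square root of $M^{-1}$ for $M\succ0$. Put $$c_1=\|K\|+\|M_1\|,\qquad c_2=\frac{\|K\|}{\sqrt{\lambda_{\min}(M_2)}}+\sqrt{\|M_2\|}.$$ **(a)** Suppose that $$M_1+\tfrac12\Sigma_f\succ0,\qquad M_2\succ0,\qquad \big\|M_2^{-1/2}K(M_1+\tfrac12\Sigma_f)^{-1/2}\big\|^2<\tfrac43 .$$ Then $(x^k,y^k)$ converges to a saddle point $(x^\infty,y^\infty)$ of $\mathcal L$. Put $\bar c=\sup_{k\ge0}\{\|x^k-x^\infty\|+\|y^k-y^\infty\|\}$ and, for $t\ge1$, let $$k(t)\in\operatorname*{argmin}_{1\le k\le t}\Big\{c_1\|x^{k+1}-x^k\|_{M_1+\frac12\Sigma_f}+c_2\|y^{k+1}-y^k\|_{M_2}\Big\}.$$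 Then there are real sequences $\varepsilon(t)=o(1/\sqrt t)$ and $\varepsilon'(t)=o(1/\sqrt t)$ as $t\to\infty$, independent of $x$, $y$ and of the choice of the minimizers $k(t)$, such that for every $t\ge1$ $$\mathcal L(x^{k(t)},y)-\mathcal L(x,y^{k(t)})\le\varepsilon(t)\,\big(\bar c+\|x^\infty-x\|+\|y^\infty-y\|\big)\qquad\forall x\in\mathbb{R}^n,\ \forall y\in\mathbb{R}^m,$$ $$\mathcal L(x^{k(t)},y^\infty)-\mathcal L(x^\infty,y^{k(t)})\le\varepsilon'(t).$$ **(b)** Suppose instead that $$M_1+\tfrac12\Sigma_f\succ0,\qquad M_2\succ0,\qquad \big\|M_2^{-1/2}K(M_1+\tfrac12\Sigma_f)^{-1/2}\big\|<1 .$$ Then, with $(x^\infty,y^\infty)$ (again the limit of the sequence, and a saddle point) and $\bar c$ as in (a), there are real sequences $\varepsilon(t)=o(1/\sqrt t)$ and $\varepsilon'(t)=o(1/\sqrt t)$, independent of $x$ and $y$, such that for every $t\ge1$ $$\mathcal L(x^{t},y)-\mathcal L(x,y^{t})\le\varepsilon(t)\,\big(\bar c+\|x^\infty-x\|+\|y^\infty-y\|\big)\qquad\forall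 x\in\mathbb{R}^n,\ \forall y\in\mathbb{R}^m,$$ $$\mathcal L(x^{t},y^\infty)-\mathcal L(x^\infty,y^{t})\le\varepsilon'(t).$$ -/

import Mathlib

open Filter Topology Asymptotics
open scoped RealInnerProductSpace Matrix MatrixOrder Matrix.Norms.L2Operator

noncomputable section

namespace PrePDHG

/-- Euclidean space of dimension `n`, with the `ℓ²` norm. -/
abbrev E (n : ℕ) := EuclideanSpace ℝ (Fin n)

/-- The matrix-vector product `A x`, with Euclidean vectors. -/
abbrev mv {m n : ℕ} (A : Matrix (Fin m) (Fin n) ℝ) (x : E n) : E m :=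
  Matrix.toEuclideanLin A x

/-- `‖z‖²_M = ⟨z, M z⟩`; it may be negative when `M` is indefinite. -/
def quad {n : ℕ} (M : Matrix (Fin n) (Fin n) ℝ) (z : E n) : ℝ := ⟪z, mv M z⟫

/-- `‖z‖_M = √⟨z, M z⟩`, used for positive definite `M`. -/
def matNorm {n : ℕ} (M : Matrix (Fin n) (Fin n) ℝ) (z : E n) : ℝ := √(quad M z)

/-- The inverse square root of a positive definite matrix: the positive semidefinite square root
of its inverse. -/
def invSqrt {n : ℕ} (M : Matrix (Fin n) (Fin n) ℝ) : Matrix (Fin n) (Fin n) ℝ := CFC.sqrt M⁻¹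

/-- The smallest eigenvalue of a symmetric matrix. -/
def lambdaMin {n : ℕ} (M : Matrix (Fin n) (Fin n) ℝ) : ℝ := sInf (spectrum ℝ M)

/-- `f : ℝⁿ → (-∞, +∞]` is proper, closed (lower semicontinuous) and convex (its epigraph is a
convex set). -/
structure ProperClosedConvex {n : ℕ} (f : E n → EReal) : Prop where
  ne_bot : ∀ x, f x ≠ ⊥
  exists_finite : ∃ x, f x ≠ ⊤
  closed : LowerSemicontinuous f
  convex : Convex ℝ {p : E n × ℝ | f p.1 ≤ (p.2 : EReal)}

/-- The convex conjugate `g*(y) = sup_z (⟨z, y⟩ - g(z))`. -/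
def conj {m : ℕ} (g : E m → EReal) (y : E m) : EReal :=
  ⨆ z : E m, ((⟪z, y⟫ : ℝ) : EReal) - g z

/-- The subdifferential; for proper `f` it is empty outside the domain of `f`. -/
def subdiff {n : ℕ} (f : E n → EReal) (x : E n) : Set (E n) :=
  {ξ | ∀ z, f x + ((⟪ξ, z - x⟫ : ℝ) : EReal) ≤ f z}

/-- `S` is a symmetric positive semidefinite matrix with
`⟨ξ₁ - ξ₂, x₁ - x₂⟩ ≥ ‖x₁ - x₂‖²_S` for all `ξᵢ ∈ ∂f(xᵢ)`. -/
def IsMonotonicityMatrix {n : ℕ} (f : E n → EReal) (S : Matrix (Fin n) (Fin n) ℝ) : Prop :=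
  S.PosSemidef ∧ ∀ x₁ x₂ ξ₁ ξ₂ : E n, ξ₁ ∈ subdiff f x₁ → ξ₂ ∈ subdiff f x₂ →
    quad S (x₁ - x₂) ≤ ⟪ξ₁ - ξ₂, x₁ - x₂⟫

/-- `L(x, y) = f(x) + ⟨K x, y⟩ - g*(y)`, with values in the extended reals. If both `f x` and
`g* y` are `+∞`, Mathlib's convention gives `-∞`; this never matters at points where `f x` or
`g* y` is finite. -/
def lagr {n m : ℕ} (K : Matrix (Fin m) (Fin n) ℝ) (f : E n → EReal) (g : E m → EReal)
    (x : E n) (y : E m) : EReal :=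
  f x + ((⟪mv K x, y⟫ : ℝ) : EReal) - conj g y

/-- `(xs, ys)` is a saddle point: `L(xs, y) ≤ L(xs, ys) ≤ L(x, ys)` for all `x`, `y`. For proper
`f` and `g*` this forces `f xs` and `g* ys` to be finite. -/
def IsSaddlePoint {n m : ℕ} (K : Matrix (Fin m) (Fin n) ℝ) (f : E n → EReal) (g : E m → EReal)
    (xs : E n) (ys : E m) : Prop :=
  (∀ y, lagr K f g xs y ≤ lagr K f g xs ys) ∧ (∀ x, lagr K f g xs ys ≤ lagr K f g x ys)

/-- The sequence `(x k, y k)`, with arbitrary initial point, is generated by the preconditioned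
primal-dual hybrid gradient iteration. -/
def IsIteration {n m : ℕ} (K : Matrix (Fin m) (Fin n) ℝ) (f : E n → EReal) (g : E m → EReal)
    (M₁ : Matrix (Fin n) (Fin n) ℝ) (M₂ : Matrix (Fin m) (Fin m) ℝ)
    (x : ℕ → E n) (y : ℕ → E m) : Prop :=
  ∀ k,
    IsMinOn (fun z => f z + ((⟪mv K z, y k⟫ + 1 / 2 * quad M₁ (z - x k) : ℝ) : EReal))
      Set.univ (x (k + 1)) ∧
    IsMinOn (fun w => conj g w +
        ((-⟪mv K ((2 : ℝ) • x (k + 1) - x k), w⟫ + 1 / 2 * quad M₂ (w - y k) : ℝ) : EReal))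
      Set.univ (y (k + 1))

/-- `M₁ + S/2 ≻ 0`, `M₂ ≻ 0`, and the squared spectral norm of
`M₂^{-1/2} K (M₁ + S/2)^{-1/2}` is less than `4/3`. -/
def FourThirdsCondition {n m : ℕ} (K : Matrix (Fin m) (Fin n) ℝ)
    (M₁ S : Matrix (Fin n) (Fin n) ℝ) (M₂ : Matrix (Fin m) (Fin m) ℝ) : Prop :=
  (M₁ + (1 / 2 : ℝ) • S).PosDef ∧ M₂.PosDef ∧
    ‖invSqrt M₂ * K * invSqrt (M₁ + (1 / 2 : ℝ) • S)‖ ^ 2 < 4 / 3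

/-- `M₁ + S/2 ≻ 0`, `M₂ ≻ 0`, and the spectral norm of `M₂^{-1/2} K (M₁ + S/2)^{-1/2}` is less
than `1`. -/
def NormLtOneCondition {n m : ℕ} (K : Matrix (Fin m) (Fin n) ℝ)
    (M₁ S : Matrix (Fin n) (Fin n) ℝ) (M₂ : Matrix (Fin m) (Fin m) ℝ) : Prop :=
  (M₁ + (1 / 2 : ℝ) • S).PosDef ∧ M₂.PosDef ∧
    ‖invSqrt M₂ * K * invSqrt (M₁ + (1 / 2 : ℝ) • S)‖ < 1

/-- `c₁ = ‖K‖ + ‖M₁‖` (spectral norms). -/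
def c₁ {n m : ℕ} (K : Matrix (Fin m) (Fin n) ℝ) (M₁ : Matrix (Fin n) (Fin n) ℝ) : ℝ :=
  ‖K‖ + ‖M₁‖

/-- `c₂ = ‖K‖ / √λ_min(M₂) + √‖M₂‖` (spectral norms). -/
def c₂ {n m : ℕ} (K : Matrix (Fin m) (Fin n) ℝ) (M₂ : Matrix (Fin m) (Fin m) ℝ) : ℝ :=
  ‖K‖ / √(lambdaMin M₂) + √‖M₂‖

/-- The weighted length of the `k`-th step,
`c₁ ‖x^{k+1} - x^k‖_{M₁ + S/2} + c₂ ‖y^{k+1} - y^k‖_{M₂}`. -/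
def stepLength {n m : ℕ} (K : Matrix (Fin m) (Fin n) ℝ)
    (M₁ S : Matrix (Fin n) (Fin n) ℝ) (M₂ : Matrix (Fin m) (Fin m) ℝ)
    (x : ℕ → E n) (y : ℕ → E m) (k : ℕ) : ℝ :=
  c₁ K M₁ * matNorm (M₁ + (1 / 2 : ℝ) • S) (x (k + 1) - x k) +
    c₂ K M₂ * matNorm M₂ (y (k + 1) - y k)

/-- `k` is an index in `{1, …, t}` at which the weighted step length is minimal. -/
def IsBestIndex {n m : ℕ} (K : Matrix (Fin m) (Fin n) ℝ)
    (M₁ S : Matrix (Fin n) (Fin n) ℝ) (M₂ : Matrix (Fin m) (Fin m) ℝ)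
    (x : ℕ → E n) (y : ℕ → E m) (t k : ℕ) : Prop :=
  k ∈ Finset.Icc 1 t ∧
    ∀ j ∈ Finset.Icc 1 t, stepLength K M₁ S M₂ x y k ≤ stepLength K M₁ S M₂ x y j

/-- `sup_k (‖x^k - x^∞‖ + ‖y^k - y^∞‖)`; the supremum is finite for convergent sequences. -/
def cBar {n m : ℕ} (x : ℕ → E n) (y : ℕ → E m) (xInf : E n) (yInf : E m) : ℝ :=
  ⨆ k, (‖x k - xInf‖ + ‖y k - yInf‖)

/-- `ε(t) = o(1/√t)` as `t → ∞`. -/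
def IsLittleOInvSqrt (ε : ℕ → ℝ) : Prop :=
  ε =o[atTop] fun t : ℕ => 1 / √(t : ℝ)

end PrePDHG

end

/-! Write `A = M + S / 2` and `J = B⁻¹ K`, and replace the dual variable by `λᵏ = yᵏ + J (xᵏ⁺¹ -
xᵏ)`. This shift absorbs the extrapolation: the dual inclusion becomes `K xᵏ⁺² - B (λᵏ⁺¹ - λᵏ) ∈
∂g*(yᵏ⁺¹)`.

Put `a = xᵏ⁺² - xᵏ⁺¹` and `d = λᵏ⁺¹ - λᵏ`. Testing both inclusions against a KKT point shows that a
weighted squared distance to it drops by at least `‖d‖²_B + ‖a‖²_A - 2 ⟪K a, d⟫` (`fejer_descent`).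
One copy of the indefinite cross term is bounded through monotonicity of `∂f` at consecutive
iterates, by a telescoping difference plus `½ ⟪K a, J a⟫` (`cross_term_le`). The other copy costs `¼
⟪K a, J a⟫` by Young's inequality. What remains is `‖a‖²_A - ¾ ⟪K a, J a⟫`, and this is the source
of the bound `4/3` on `ρ`, the squared norm of the preconditioned matrix (`residual_coercive`).
Hence a Lyapunov function decreases and the steps are square summable (`summable_steps`).
Compactness, closed graphs and the same descent at a cluster point then give convergence
(`exists_tendsto_isKKT`).

For the rates, subgradient inequalities at two consecutive iterates bound the gap at iterate `k ≥ 1`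
by the step from `k` to `k + 1` (`exists_gap_bound`). The smallest of the first `t` terms of a
square summable sequence is `o(1/√t)`, which gives (a). If `ρ < 1`, a quadratic form of the steps is
nonincreasing (`residualForm_step_le`), so the latest step is as good as the best one, which gives
(b). -/

namespace PrePDHG

/-! ### Quadratic inequalities behind the descent -/

section Descent

variable {V W : Type*} [NormedAddCommGroup V] [InnerProductSpace ℝ V]
  [NormedAddCommGroup W] [InnerProductSpace ℝ W]

/-- Fejér-type descent of the distance to a KKT point, up to a cross term. -/
lemma fejer_descent {K J : V →L[ℝ] W} {M S : V →L[ℝ] V} {B : W →L[ℝ] W}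
    (hM : ∀ u v, ⟪M u, v⟫ = ⟪u, M v⟫) (hS : ∀ u v, ⟪S u, v⟫ = ⟪u, S v⟫)
    (hB : ∀ u v, ⟪B u, v⟫ = ⟪u, B v⟫) (hJ : ∀ u, B (J u) = K u)
    (hS0 : ∀ u, 0 ≤ ⟪S u, u⟫) (X a : V) (Λ d : W)
    (h1 : ⟪S X, X⟫ ≤ -⟪K X, Λ - J a⟫ - ⟪M a, X⟫)
    (h2 : 0 ≤ ⟪K X - B d, Λ - J a⟫) :
    ⟪M X, X⟫ + ⟪S X, X⟫ + ⟪B Λ, Λ⟫ ≤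
      ⟪M (X - a), X - a⟫ + ⟪S (X - a), X - a⟫ + ⟪B (Λ - d), Λ - d⟫
        - (⟪B d, d⟫ + (⟪M a, a⟫ + 1 / 2 * ⟪S a, a⟫) - 2 * ⟪K a, d⟫) := by
  -- In `h1 + h2` the terms with `K X` cancel, and polarization handles `M` and `B`. For `S`, half
  -- of `h3` trades `2 ⟪S X, X⟫` for the difference of the `S`-terms at `X` and `X - a` plus `½ ⟪S
  -- a, a⟫`.
  have h3 := hS0 (X + (X - a))
  have e1 : ⟪B d, J a⟫ = ⟪K a, d⟫ := by rw [hB, hJ, real_inner_comm]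
  have e2 : ⟪M X, a⟫ = ⟪M a, X⟫ := by rw [hM, real_inner_comm]
  have e3 : ⟪S X, a⟫ = ⟪S a, X⟫ := by rw [hS, real_inner_comm]
  have e4 : ⟪B Λ, d⟫ = ⟪B d, Λ⟫ := by rw [hB, real_inner_comm]
  simp only [map_sub, map_add, inner_sub_left, inner_sub_right, inner_add_left,
    inner_add_right] at *
  linarith

/-- The monotonicity of the primal subdifferential at consecutive iterates bounds the cross term
by a telescoping difference. -/
lemma cross_term_le {K J : V →L[ℝ] W} {M S : V →L[ℝ] V} {B : W →L[ℝ] W}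
    (hM : ∀ u v, ⟪M u, v⟫ = ⟪u, M v⟫) (hS : ∀ u v, ⟪S u, v⟫ = ⟪u, S v⟫)
    (hB : ∀ u v, ⟪B u, v⟫ = ⟪u, B v⟫) (hJ : ∀ u, B (J u) = K u)
    (hS0 : ∀ u, 0 ≤ ⟪S u, u⟫) (hN0 : ∀ u, 0 ≤ ⟪K u, J u⟫)
    (hρ : ∀ u, 3 / 4 * ⟪K u, J u⟫ ≤ ⟪M u, u⟫ + 1 / 2 * ⟪S u, u⟫)
    (a a' : V) (d : W)
    (h : ⟪S a, a⟫ ≤ -⟪K a, d - J (a - a')⟫ - ⟪M (a - a'), a⟫) :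
    ⟪K a, d⟫ ≤
      (1 / 2 * (⟪M a', a'⟫ + 1 / 2 * ⟪S a', a'⟫) - 1 / 4 * ⟪K a', J a'⟫ + 1 / 4 * ⟪S a', a'⟫)
      - (1 / 2 * (⟪M a, a⟫ + 1 / 2 * ⟪S a, a⟫) - 1 / 4 * ⟪K a, J a⟫ + 1 / 4 * ⟪S a, a⟫)
      + 1 / 2 * ⟪K a, J a⟫ := by
  -- The claim is `h` plus `h3`, `h4`, `h5` with weights `1/4`, `1/2`, `1/8`.
  have h3 := hS0 (a + a')
  have h4 := hρ (a - a')
  have h5 := hN0 (a + a')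
  have e1 : ⟪K a', J a⟫ = ⟪K a, J a'⟫ := by rw [← hJ, hB, hJ, real_inner_comm]
  have e2 : ⟪M a, a'⟫ = ⟪M a', a⟫ := by rw [hM, real_inner_comm]
  have e3 : ⟪S a, a'⟫ = ⟪S a', a⟫ := by rw [hS, real_inner_comm]
  simp only [map_sub, map_add, inner_sub_left, inner_sub_right, inner_add_left,
    inner_add_right] at *
  linarith

/-- Coercivity of the residual when the coupling constant is below `4/3`. -/
lemma residual_coercive {K J : V →L[ℝ] W} {B : W →L[ℝ] W} {ρ q : ℝ}
    (hB : ∀ u v, ⟪B u, v⟫ = ⟪u, B v⟫) (hJ : ∀ u, B (J u) = K u)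
    (hB0 : ∀ u, 0 ≤ ⟪B u, u⟫) (hρ0 : 0 ≤ ρ) (hρ : ρ < 4 / 3) (a : V) (d : W)
    (hN : ⟪K a, J a⟫ ≤ ρ * q) (hq : 0 ≤ q) :
    (4 - 3 * ρ) / 16 * (⟪B d, d⟫ + q) ≤
      ⟪B d, d⟫ + q - ⟪K a, d⟫ - 1 / 2 * ⟪K a, J a⟫ := by
  -- `s` measures the distance of `ρ` from `4/3`: `ρ = 4/3 (1 - 4 s)`.
  obtain ⟨s, hs⟩ : ∃ s, s = (4 - 3 * ρ) / 16 := ⟨_, rfl⟩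
  have hs0 : 0 < s := by rw [hs]; linarith
  have hs1 : s ≤ 1 / 4 := by rw [hs]; linarith
  have hρs : ρ = 4 / 3 * (1 - 4 * s) := by rw [hs]; ring
  rw [← hs]
  -- Young's inequality balanced so that exactly `s ⟪B d, d⟫` survives.
  have h := hB0 (d - (1 / (2 * (1 - s))) • J a)
  have e1 : ⟪K a, J a⟫ = ⟪B (J a), J a⟫ := by rw [hJ]
  have e2 : ⟪B d, J a⟫ = ⟪K a, d⟫ := by rw [hB, hJ, real_inner_comm]
  simp only [map_sub, map_smul, inner_sub_left, inner_sub_right, inner_smul_left,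
    inner_smul_right, hJ, e2] at h
  simp only [conj_trivial] at h
  have h1s : 0 < 1 - s := by linarith
  have key : (1 - s) * ⟪K a, d⟫ ≤ (1 - s) ^ 2 * ⟪B d, d⟫ + 1 / 4 * ⟪K a, J a⟫ := by
    have h' := mul_nonneg (sq_nonneg (1 - s)) h
    field_simp at h'
    nlinarith
  have hmain : (3 - 2 * s) / 4 * ⟪K a, J a⟫ ≤ (1 - s) ^ 2 * q := by
    have h6 : (3 - 2 * s) / 4 * ⟪K a, J a⟫ ≤ (3 - 2 * s) / 4 * (ρ * q) :=
      mul_le_mul_of_nonneg_left hN (by linarith)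
    have h7 : (3 - 2 * s) / 4 * (ρ * q) ≤ (1 - s) ^ 2 * q := by
      rw [← mul_assoc]
      apply mul_le_mul_of_nonneg_right _ hq
      rw [hρs]; nlinarith
    exact h6.trans h7
  have : 0 ≤ (1 - s) * (⟪B d, d⟫ + q - ⟪K a, d⟫ - 1 / 2 * ⟪K a, J a⟫ - s * (⟪B d, d⟫ + q)) := by
    nlinarith
  have := nonneg_of_mul_nonneg_right this h1s
  linarith

end Descent

/-! ### Summable sequences and `o(1/√t)` -/

section Sequences

/-- Nonnegative sequence with controlled decrements has summable decrements. -/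
lemma summable_of_descent {Φ r : ℕ → ℝ} (hΦ : ∀ k, 0 ≤ Φ k) (hr : ∀ k, 0 ≤ r k)
    (h : ∀ k, Φ (k + 1) ≤ Φ k - r k) : Summable r := by
  refine summable_of_sum_range_le (c := Φ 0) hr fun N => ?_
  have : ∀ N, ∑ i ∈ Finset.range N, r i ≤ Φ 0 - Φ N := by
    intro N
    induction N with
    | zero => simp
    | succ N ih => rw [Finset.sum_range_succ]; linarith [h N]
  linarith [this N, hΦ N]

/-- Lower bounds of the first `t` terms of a summable nonnegative sequence are `o(1/t)`; stated for
square roots. -/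
lemma isLittleOInvSqrt_of_le_summable {r μ : ℕ → ℝ} (hr : ∀ k, 0 ≤ r k) (hsum : Summable r)
    (hμ0 : ∀ t, 0 ≤ μ t) (hμ : ∀ t, ∀ j, 1 ≤ j → j ≤ t → μ t ^ 2 ≤ r j) :
    IsLittleOInvSqrt μ := by
  have htail : Tendsto (fun i => ∑' k, r (k + i)) atTop (𝓝 0) := tendsto_sum_nat_add r
  -- Summing over the block `t / 2 < j ≤ t` only: it has at least `t / 2` terms, and its sum is
  -- bounded by a tail, which tends to zero.
  have hhalf : Tendsto (fun t : ℕ => t / 2 + 1) atTop atTop := by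
    refine tendsto_atTop_mono (fun t => ?_) (Nat.tendsto_div_const_atTop (n := 2) (by norm_num))
    omega
  have htail' := htail.comp hhalf
  rw [IsLittleOInvSqrt, isLittleO_iff]
  intro c hc
  have hev := htail'.eventually (gt_mem_nhds (show (0 : ℝ) < c ^ 2 / 4 by positivity))
  filter_upwards [hev, eventually_ge_atTop 2] with t ht ht2
  have htpos : (0 : ℝ) < t := by exact_mod_cast (by omega : 0 < t)
  have hbd : ((t - t / 2 : ℕ) : ℝ) * μ t ^ 2 ≤ ∑' k, r (k + (t / 2 + 1)) := by
    have h1 : ∑ k ∈ Finset.range (t - t / 2), μ t ^ 2 ≤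
        ∑ k ∈ Finset.range (t - t / 2), r (k + (t / 2 + 1)) := by
      refine Finset.sum_le_sum fun k hk => hμ t _ (by omega) ?_
      have := Finset.mem_range.1 hk
      omega
    have h2 := Summable.sum_le_tsum (Finset.range (t - t / 2)) (fun k _ => hr (k + (t / 2 + 1)))
      ((summable_nat_add_iff (t / 2 + 1)).2 hsum)
    simp only [Finset.sum_const, Finset.card_range, nsmul_eq_mul] at h1
    exact h1.trans h2
  have hcast : (t : ℝ) / 2 ≤ ((t - t / 2 : ℕ) : ℝ) := by
    have : t ≤ 2 * (t - t / 2) := by omega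
    have : (t : ℝ) ≤ 2 * ((t - t / 2 : ℕ) : ℝ) := by exact_mod_cast this
    linarith
  have hm : (t : ℝ) * μ t ^ 2 ≤ c ^ 2 := by
    simp only [Function.comp] at ht
    nlinarith [mul_le_mul_of_nonneg_right hcast (sq_nonneg (μ t))]
  rw [Real.norm_of_nonneg (hμ0 t), Real.norm_of_nonneg (by positivity), mul_one_div,
    le_div_iff₀ (Real.sqrt_pos.2 htpos)]
  refine abs_le_of_sq_le_sq' ?_ hc.le |>.2
  rw [mul_pow, Real.sq_sqrt htpos.le]
  linarith

end Sequences

/-! ### Lyapunov function and convergence to a KKT point -/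

section Convergence

variable {V W : Type*} [NormedAddCommGroup V] [InnerProductSpace ℝ V]
  [NormedAddCommGroup W] [InnerProductSpace ℝ W]

/-- The operators of the iteration in abstract form: `Kt` is the adjoint of `K`, `J = B⁻¹ K`,
`M + S / 2` and `B` are coercive and `Kt J ≤ ρ (M + S / 2)`. -/
structure Coupling (K J : V →L[ℝ] W) (Kt : W →L[ℝ] V) (M S : V →L[ℝ] V) (B : W →L[ℝ] W)
    (ρ α β : ℝ) : Prop where
  adj : ∀ u w, ⟪K u, w⟫ = ⟪u, Kt w⟫
  symm_M : ∀ u v, ⟪M u, v⟫ = ⟪u, M v⟫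
  symm_S : ∀ u v, ⟪S u, v⟫ = ⟪u, S v⟫
  symm_B : ∀ u v, ⟪B u, v⟫ = ⟪u, B v⟫
  B_J : ∀ u, B (J u) = K u
  S_nonneg : ∀ u, 0 ≤ ⟪S u, u⟫
  α_pos : 0 < α
  β_pos : 0 < β
  coercive_A : ∀ u, α * ‖u‖ ^ 2 ≤ ⟪M u, u⟫ + 1 / 2 * ⟪S u, u⟫
  coercive_B : ∀ w, β * ‖w‖ ^ 2 ≤ ⟪B w, w⟫
  ρ_nonneg : 0 ≤ ρ
  le_ρ : ∀ u, ⟪K u, J u⟫ ≤ ρ * (⟪M u, u⟫ + 1 / 2 * ⟪S u, u⟫)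

/-- The optimality conditions of the iteration, for set-valued maps `F` and `G` in the place of the
subdifferentials. -/
structure Iterates (K : V →L[ℝ] W) (Kt : W →L[ℝ] V) (M : V →L[ℝ] V) (B : W →L[ℝ] W)
    (F : V → Set V) (G : W → Set W) (x : ℕ → V) (y : ℕ → W) : Prop where
  primal : ∀ k, -Kt (y k) - M (x (k + 1) - x k) ∈ F (x (k + 1))
  dual : ∀ k, K (x (k + 1) + (x (k + 1) - x k)) - B (y (k + 1) - y k) ∈ G (y (k + 1))

/-- `F` is monotone with modulus `S`. -/
def MonoWith (S : V →L[ℝ] V) (F : V → Set V) : Prop :=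
  ∀ x₁ x₂ ξ₁ ξ₂, ξ₁ ∈ F x₁ → ξ₂ ∈ F x₂ → ⟪S (x₁ - x₂), x₁ - x₂⟫ ≤ ⟪ξ₁ - ξ₂, x₁ - x₂⟫

/-- `F` has a sequentially closed graph. -/
def ClosedGraph (F : V → Set V) : Prop :=
  ∀ (x ξ : ℕ → V) (x' ξ' : V), (∀ k, ξ k ∈ F (x k)) → Tendsto x atTop (𝓝 x') →
    Tendsto ξ atTop (𝓝 ξ') → ξ' ∈ F x'

/-- The Karush-Kuhn-Tucker conditions. -/
def IsKKT (K : V →L[ℝ] W) (Kt : W →L[ℝ] V) (F : V → Set V) (G : W → Set W) (xs : V) (ys : W) :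
    Prop :=
  -Kt ys ∈ F xs ∧ K xs ∈ G ys

/-- The part of the Lyapunov function that depends on the last primal step. -/
noncomputable def stepPotential (K J : V →L[ℝ] W) (M S : V →L[ℝ] V) (a : V) : ℝ :=
  1 / 2 * (⟪M a, a⟫ + 1 / 2 * ⟪S a, a⟫) - 1 / 4 * ⟪K a, J a⟫ + 1 / 4 * ⟪S a, a⟫

/-- The part of the Lyapunov function that measures the distance to `(xs, ys)`. -/
noncomputable def distPotential (J : V →L[ℝ] W) (M S : V →L[ℝ] V) (B : W →L[ℝ] W)
    (x : ℕ → V) (y : ℕ → W) (xs : V) (ys : W) (k : ℕ) : ℝ :=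
  ⟪M (x (k + 1) - xs), x (k + 1) - xs⟫ + ⟪S (x (k + 1) - xs), x (k + 1) - xs⟫ +
    ⟪B (y k + J (x (k + 1) - x k) - ys), y k + J (x (k + 1) - x k) - ys⟫

variable {K J : V →L[ℝ] W} {Kt : W →L[ℝ] V} {M S : V →L[ℝ] V} {B : W →L[ℝ] W} {ρ α β : ℝ}
  {F : V → Set V} {G : W → Set W} {x : ℕ → V} {y : ℕ → W}

lemma Coupling.B_nonneg (h : Coupling K J Kt M S B ρ α β) (w : W) : 0 ≤ ⟪B w, w⟫ :=
  (mul_nonneg h.β_pos.le (sq_nonneg _)).trans (h.coercive_B w)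

lemma Coupling.A_nonneg (h : Coupling K J Kt M S B ρ α β) (u : V) :
    0 ≤ ⟪M u, u⟫ + 1 / 2 * ⟪S u, u⟫ :=
  (mul_nonneg h.α_pos.le (sq_nonneg _)).trans (h.coercive_A u)

lemma Coupling.N_nonneg (h : Coupling K J Kt M S B ρ α β) (u : V) : 0 ≤ ⟪K u, J u⟫ := by
  rw [← h.B_J]; exact h.B_nonneg _

lemma Coupling.three_quarters (h : Coupling K J Kt M S B ρ α β) (hρ : ρ < 4 / 3) (u : V) :
    3 / 4 * ⟪K u, J u⟫ ≤ ⟪M u, u⟫ + 1 / 2 * ⟪S u, u⟫ := by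
  nlinarith [h.le_ρ u, h.A_nonneg u]

lemma Coupling.stepPotential_nonneg (h : Coupling K J Kt M S B ρ α β) (hρ : ρ < 4 / 3) (u : V) :
    0 ≤ stepPotential K J M S u := by
  unfold stepPotential
  linarith [h.three_quarters hρ u, h.S_nonneg u, h.N_nonneg u, h.A_nonneg u]

lemma Coupling.distPotential_ge (h : Coupling K J Kt M S B ρ α β) (xs : V) (ys : W) (k : ℕ) :
    α * ‖x (k + 1) - xs‖ ^ 2 + β * ‖y k + J (x (k + 1) - x k) - ys‖ ^ 2 ≤
      distPotential J M S B x y xs ys k := by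
  unfold distPotential
  linarith [h.coercive_A (x (k + 1) - xs), h.S_nonneg (x (k + 1) - xs),
    h.coercive_B (y k + J (x (k + 1) - x k) - ys)]

lemma Coupling.distPotential_nonneg (h : Coupling K J Kt M S B ρ α β) (xs : V) (ys : W) (k : ℕ) :
    0 ≤ distPotential J M S B x y xs ys k :=
  le_trans (add_nonneg (mul_nonneg h.α_pos.le (sq_nonneg _)) (mul_nonneg h.β_pos.le (sq_nonneg _)))
    (h.distPotential_ge xs ys k)

/-- The Lyapunov function decreases along the iteration. -/
lemma potential_descent (h : Coupling K J Kt M S B ρ α β) (hρ : ρ < 4 / 3)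
    (hF : MonoWith S F) (hG : MonoWith 0 G) (hit : Iterates K Kt M B F G x y)
    {xs : V} {ys : W} (hs : IsKKT K Kt F G xs ys) (k : ℕ) :
    distPotential J M S B x y xs ys (k + 1) + stepPotential K J M S (x (k + 2) - x (k + 1)) ≤
      distPotential J M S B x y xs ys k + stepPotential K J M S (x (k + 1) - x k) -
      (4 - 3 * ρ) / 16 *
        (⟪B (y (k + 1) + J (x (k + 2) - x (k + 1)) - (y k + J (x (k + 1) - x k))),
            y (k + 1) + J (x (k + 2) - x (k + 1)) - (y k + J (x (k + 1) - x k))⟫ +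
          (⟪M (x (k + 2) - x (k + 1)), x (k + 2) - x (k + 1)⟫ +
            1 / 2 * ⟪S (x (k + 2) - x (k + 1)), x (k + 2) - x (k + 1)⟫)) := by
  have p1 := hF _ _ _ _ (hit.primal (k + 1)) hs.1
  have p2 := hG _ _ _ _ (hit.dual k) hs.2
  have p3 := hF _ _ _ _ (hit.primal (k + 1)) (hit.primal k)
  have hadj := h.adj
  have hBJ := h.B_J
  obtain ⟨a, ha⟩ : ∃ a, a = x (k + 2) - x (k + 1) := ⟨_, rfl⟩
  obtain ⟨a', ha'⟩ : ∃ a, a = x (k + 1) - x k := ⟨_, rfl⟩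
  obtain ⟨d, hd⟩ : ∃ d, d = y (k + 1) + J a - (y k + J a') := ⟨_, rfl⟩
  obtain ⟨X, hX⟩ : ∃ X, X = x (k + 2) - xs := ⟨_, rfl⟩
  obtain ⟨Λ, hΛ⟩ : ∃ Λ, Λ = y (k + 1) + J a - ys := ⟨_, rfl⟩
  rw [show k + 1 + 1 = k + 2 from rfl] at p1 p3
  have f := fejer_descent h.symm_M h.symm_S h.symm_B h.B_J h.S_nonneg X a Λ d (by
      have e : ⟪K X, Λ - J a⟫ = ⟪Kt (y (k + 1) - ys), X⟫ := by
        rw [hadj, real_inner_comm, hΛ]; congr 2; abel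
      rw [e]
      rw [← hX, ← ha] at p1
      refine p1.trans (le_of_eq ?_)
      rw [← inner_neg_left, ← inner_sub_left]
      congr 1
      rw [map_sub]; abel) (by
      -- Since `B J = K`, the two corrections in `B d` convert the extrapolated point into `x (k +
      -- 2)`.
      have e1 : K X - B d = K (x (k + 1) + (x (k + 1) - x k)) - B (y (k + 1) - y k) - K xs := by
        rw [hX, hd, ha, ha']
        simp only [map_sub, map_add, hBJ]
        abel
      have e2 : Λ - J a = y (k + 1) - ys := by rw [hΛ]; abel
      rw [e1, e2]
      simpa using p2)
  have c := cross_term_le h.symm_M h.symm_S h.symm_B h.B_J h.S_nonneg h.N_nonneg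
    (h.three_quarters hρ) a a' d (by
      have e : ⟪K a, d - J (a - a')⟫ = ⟪Kt (y (k + 1) - y k), a⟫ := by
        rw [hadj, real_inner_comm, hd]; congr 2; rw [map_sub]; abel
      rw [e]
      rw [← ha, ← ha'] at p3
      refine p3.trans (le_of_eq ?_)
      rw [← inner_neg_left, ← inner_sub_left]
      congr 1
      simp only [map_sub]; abel)
  -- `f` loses the cross term twice: `c` pays for one copy, `r` absorbs the other.
  have r := residual_coercive h.symm_B h.B_J h.B_nonneg h.ρ_nonneg hρ a d (h.le_ρ a)
    (h.A_nonneg a)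
  have e1 : X - a = x (k + 1) - xs := by rw [hX, ha]; abel
  have e2 : Λ - d = y k + J a' - ys := by rw [hΛ, hd]; abel
  rw [e1, e2] at f
  unfold distPotential stepPotential
  rw [show k + 1 + 1 = k + 2 from rfl, ← ha, ← ha', ← hd, ← hX, ← hΛ]
  linarith

lemma sq_norm_add_le_two {U : Type*} [SeminormedAddCommGroup U] (u v : U) :
    ‖u + v‖ ^ 2 ≤ 2 * ‖u‖ ^ 2 + 2 * ‖v‖ ^ 2 := by
  have h := pow_le_pow_left₀ (norm_nonneg _) (norm_add_le u v) 2
  nlinarith [sq_nonneg (‖u‖ - ‖v‖)]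

/-- The squared step lengths of the iteration are summable. -/
lemma summable_steps (h : Coupling K J Kt M S B ρ α β) (hρ : ρ < 4 / 3)
    (hF : MonoWith S F) (hG : MonoWith 0 G) (hit : Iterates K Kt M B F G x y)
    {xs : V} {ys : W} (hs : IsKKT K Kt F G xs ys) :
    Summable (fun k => ‖x (k + 1) - x k‖ ^ 2) ∧ Summable (fun k => ‖y (k + 1) - y k‖ ^ 2) := by
  have hsum := summable_of_descent
    (Φ := fun k => distPotential J M S B x y xs ys k + stepPotential K J M S (x (k + 1) - x k))
    (fun k => add_nonneg (h.distPotential_nonneg xs ys k) (h.stepPotential_nonneg hρ _))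
    (fun k => mul_nonneg (by linarith) (add_nonneg (h.B_nonneg _) (h.A_nonneg _)))
    (potential_descent h hρ hF hG hit hs)
  have hc : (4 - 3 * ρ) / 16 ≠ 0 := by linarith
  rw [summable_mul_left_iff hc] at hsum
  have ha : Summable (fun k => ‖x (k + 2) - x (k + 1)‖ ^ 2) := by
    refine (summable_mul_left_iff h.α_pos.ne').1
      (Summable.of_nonneg_of_le (fun k => mul_nonneg h.α_pos.le (sq_nonneg _)) (fun k => ?_) hsum)
    linarith [h.coercive_A (x (k + 2) - x (k + 1)), h.B_nonneg
      (y (k + 1) + J (x (k + 2) - x (k + 1)) - (y k + J (x (k + 1) - x k)))]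
  have ha' : Summable (fun k => ‖x (k + 1) - x k‖ ^ 2) := (summable_nat_add_iff 1).1 ha
  have hd : Summable (fun k =>
      ‖y (k + 1) + J (x (k + 2) - x (k + 1)) - (y k + J (x (k + 1) - x k))‖ ^ 2) := by
    refine (summable_mul_left_iff h.β_pos.ne').1
      (Summable.of_nonneg_of_le (fun k => mul_nonneg h.β_pos.le (sq_nonneg _)) (fun k => ?_) hsum)
    linarith [h.A_nonneg (x (k + 2) - x (k + 1)), h.coercive_B
      (y (k + 1) + J (x (k + 2) - x (k + 1)) - (y k + J (x (k + 1) - x k)))]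
  refine ⟨ha', Summable.of_nonneg_of_le (fun k => sq_nonneg _) (fun k => ?_)
    ((hd.mul_left 2).add (((ha.mul_left (4 * ‖J‖ ^ 2))).add (ha'.mul_left (4 * ‖J‖ ^ 2))))⟩
  have hJ : ∀ u, ‖J u‖ ^ 2 ≤ ‖J‖ ^ 2 * ‖u‖ ^ 2 := fun u => by
    rw [← mul_pow]; exact pow_le_pow_left₀ (norm_nonneg _) (J.le_opNorm u) 2
  -- The dual step is recovered from the step of the shifted variable and two consecutive primal
  -- steps.
  have e : y (k + 1) - y k =
      (y (k + 1) + J (x (k + 2) - x (k + 1)) - (y k + J (x (k + 1) - x k))) +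
        (-J (x (k + 2) - x (k + 1)) + J (x (k + 1) - x k)) := by abel
  rw [e]
  have h1 := sq_norm_add_le_two
    (y (k + 1) + J (x (k + 2) - x (k + 1)) - (y k + J (x (k + 1) - x k)))
    (-J (x (k + 2) - x (k + 1)) + J (x (k + 1) - x k))
  have h2 := sq_norm_add_le_two (-J (x (k + 2) - x (k + 1))) (J (x (k + 1) - x k))
  rw [norm_neg] at h2
  linarith [hJ (x (k + 2) - x (k + 1)), hJ (x (k + 1) - x k)]

lemma tendsto_zero_of_summable_sq {U : Type*} [SeminormedAddCommGroup U] {u : ℕ → U}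
    (h : Summable fun k => ‖u k‖ ^ 2) : Tendsto u atTop (𝓝 0) := by
  have := h.tendsto_atTop_zero.sqrt
  simp only [Real.sqrt_sq (norm_nonneg _), Real.sqrt_zero] at this
  exact tendsto_zero_iff_norm_tendsto_zero.2 this

/-- The iteration converges to a KKT point. -/
theorem exists_tendsto_isKKT [ProperSpace V] [ProperSpace W]
    (h : Coupling K J Kt M S B ρ α β) (hρ : ρ < 4 / 3)
    (hF : MonoWith S F) (hG : MonoWith 0 G) (hFc : ClosedGraph F) (hGc : ClosedGraph G)
    (hit : Iterates K Kt M B F G x y) (hs : ∃ xs ys, IsKKT K Kt F G xs ys) :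
    ∃ x' y', Tendsto x atTop (𝓝 x') ∧ Tendsto y atTop (𝓝 y') ∧ IsKKT K Kt F G x' y' := by
  obtain ⟨xs, ys, hs⟩ := hs
  obtain ⟨hsa, hsb⟩ := summable_steps h hρ hF hG hit hs
  have ha := tendsto_zero_of_summable_sq hsa
  have hb := tendsto_zero_of_summable_sq hsb
  -- Stated for every KKT point: the given one yields boundedness, and the cluster point yields
  -- convergence of the whole sequence.
  have hanti : ∀ xs ys, IsKKT K Kt F G xs ys → Antitone (fun k =>
      distPotential J M S B x y xs ys k + stepPotential K J M S (x (k + 1) - x k)) :=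
    fun xs ys hs => antitone_nat_of_succ_le fun k => by
      have h1 := potential_descent h hρ hF hG hit hs k
      have h2 := mul_nonneg (show 0 ≤ (4 - 3 * ρ) / 16 by linarith) (add_nonneg
        (h.B_nonneg (y (k + 1) + J (x (k + 2) - x (k + 1)) - (y k + J (x (k + 1) - x k))))
        (h.A_nonneg (x (k + 2) - x (k + 1))))
      linarith
  obtain ⟨C, hC⟩ : ∃ C, ∀ k, distPotential J M S B x y xs ys k ≤ C :=
    ⟨distPotential J M S B x y xs ys 0 + stepPotential K J M S (x (0 + 1) - x 0), fun k => by
      have h1 := hanti xs ys hs (Nat.zero_le k)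
      have h2 := h.stepPotential_nonneg hρ (x (k + 1) - x k)
      dsimp only at h1
      linarith⟩
  -- extraction of a convergent subsequence
  have hbx : ∀ k, x (k + 1) ∈ Metric.closedBall xs (√(C / α)) := fun k => by
    rw [mem_closedBall_iff_norm]
    refine Real.le_sqrt_of_sq_le ((le_div_iff₀ h.α_pos).2 ?_)
    linarith [hC k, h.distPotential_ge (x := x) (y := y) xs ys k,
      mul_nonneg h.β_pos.le (sq_nonneg ‖y k + J (x (k + 1) - x k) - ys‖)]
  have hby : ∀ k, y k + J (x (k + 1) - x k) ∈ Metric.closedBall ys (√(C / β)) := fun k => by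
    rw [mem_closedBall_iff_norm]
    refine Real.le_sqrt_of_sq_le ((le_div_iff₀ h.β_pos).2 ?_)
    linarith [hC k, h.distPotential_ge (x := x) (y := y) xs ys k,
      mul_nonneg h.α_pos.le (sq_nonneg ‖x (k + 1) - xs‖)]
  obtain ⟨x', -, φ, hφ, hφx⟩ := (isCompact_closedBall xs (√(C / α))).tendsto_subseq hbx
  obtain ⟨y', -, ψ, hψ, hψy⟩ :=
    (isCompact_closedBall ys (√(C / β))).tendsto_subseq (fun k => hby (φ k))
  have hθ := hφ.tendsto_atTop.comp hψ.tendsto_atTop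
  set θ := φ ∘ ψ with hθdef
  have tx1 : Tendsto (fun j => x (θ j + 1)) atTop (𝓝 x') := hφx.comp hψ.tendsto_atTop
  have tl : Tendsto (fun j => y (θ j) + J (x (θ j + 1) - x (θ j))) atTop (𝓝 y') := hψy
  have ta : Tendsto (fun j => x (θ j + 1) - x (θ j)) atTop (𝓝 0) := ha.comp hθ
  have tb : Tendsto (fun j => y (θ j + 1) - y (θ j)) atTop (𝓝 0) := hb.comp hθ
  have tJa : Tendsto (fun j => J (x (θ j + 1) - x (θ j))) atTop (𝓝 0) := by
    exact map_zero J ▸ (J.continuous.tendsto 0).comp ta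
  have ty : Tendsto (fun j => y (θ j)) atTop (𝓝 y') := by
    simpa using tl.sub tJa
  have ty1 : Tendsto (fun j => y (θ j + 1)) atTop (𝓝 y') := by
    simpa using ty.add tb
  have hkkt : IsKKT K Kt F G x' y' := by
    refine ⟨hFc _ _ _ _ (fun j => hit.primal (θ j)) tx1 ?_,
      hGc _ _ _ _ (fun j => hit.dual (θ j)) ty1 ?_⟩
    · simpa using ((Kt.continuous.tendsto _).comp ty).neg.sub ((M.continuous.tendsto 0).comp ta)
    · simpa using ((K.continuous.tendsto _).comp (tx1.add ta)).sub
        ((B.continuous.tendsto 0).comp tb)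
  -- the Lyapunov function for the limit point tends to zero
  have hsub : Tendsto (fun j => distPotential J M S B x y x' y' (θ j) +
      stepPotential K J M S (x (θ j + 1) - x (θ j))) atTop (𝓝 0) := by
    have t1 : Tendsto (fun j => x (θ j + 1) - x') atTop (𝓝 0) := by
      simpa using tx1.sub_const x'
    have t2 : Tendsto (fun j => y (θ j) + J (x (θ j + 1) - x (θ j)) - y') atTop (𝓝 0) := by
      simpa using tl.sub_const y'
    have c1 : Continuous (fun u : V => ⟪M u, u⟫ + ⟪S u, u⟫) := by fun_prop
    have c2 : Continuous (fun w : W => ⟪B w, w⟫) := by fun_prop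
    have c3 : Continuous (stepPotential K J M S) := by unfold stepPotential; fun_prop
    have := (((c1.tendsto 0).comp t1).add ((c2.tendsto 0).comp t2)).add ((c3.tendsto 0).comp ta)
    simpa [stepPotential, distPotential, Function.comp_def] using this
  have hΦ : Tendsto (fun k => distPotential J M S B x y x' y' k +
      stepPotential K J M S (x (k + 1) - x k)) atTop (𝓝 0) := by
    refine tendsto_order.2 ⟨fun c hc => Eventually.of_forall fun k => hc.trans_le
      (add_nonneg (h.distPotential_nonneg x' y' k) (h.stepPotential_nonneg hρ _)), fun c hc => ?_⟩
    obtain ⟨j, hj⟩ := (hsub.eventually (gt_mem_nhds hc)).exists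
    exact (eventually_ge_atTop (θ j)).mono fun k hk => (hanti x' y' hkkt hk).trans_lt hj
  have hge : ∀ k, α * ‖x (k + 1) - x'‖ ^ 2 + β * ‖y k + J (x (k + 1) - x k) - y'‖ ^ 2 ≤
      distPotential J M S B x y x' y' k + stepPotential K J M S (x (k + 1) - x k) := fun k => by
    linarith [h.distPotential_ge (x := x) (y := y) x' y' k,
      h.stepPotential_nonneg hρ (x (k + 1) - x k)]
  have sqz : ∀ (u : ℕ → ℝ) (c : ℝ), 0 < c → (∀ k, 0 ≤ u k) →
      (∀ k, c * u k ^ 2 ≤ distPotential J M S B x y x' y' k +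
        stepPotential K J M S (x (k + 1) - x k)) → Tendsto u atTop (𝓝 0) := by
    intro u c hc hu0 hu
    have h1 : Tendsto (fun k => c * u k ^ 2) atTop (𝓝 0) :=
      squeeze_zero (fun k => mul_nonneg hc.le (sq_nonneg _)) hu hΦ
    have h2 := (h1.const_mul c⁻¹).sqrt
    simpa [inv_mul_cancel_left₀ hc.ne', Real.sqrt_sq (hu0 _)] using h2
  have lx : Tendsto (fun k => x (k + 1) - x') atTop (𝓝 0) :=
    tendsto_zero_iff_norm_tendsto_zero.2 (sqz _ α h.α_pos (fun k => norm_nonneg _) fun k => by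
      linarith [hge k, mul_nonneg h.β_pos.le (sq_nonneg ‖y k + J (x (k + 1) - x k) - y'‖)])
  have ly : Tendsto (fun k => y k + J (x (k + 1) - x k) - y') atTop (𝓝 0) :=
    tendsto_zero_iff_norm_tendsto_zero.2 (sqz _ β h.β_pos (fun k => norm_nonneg _) fun k => by
      linarith [hge k, mul_nonneg h.α_pos.le (sq_nonneg ‖x (k + 1) - x'‖)])
  refine ⟨x', y', (tendsto_add_atTop_iff_nat 1).1 (by simpa using lx.add_const x'), ?_, hkkt⟩
  have tJ : Tendsto (fun k => J (x (k + 1) - x k)) atTop (𝓝 0) := by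
    exact map_zero J ▸ (J.continuous.tendsto 0).comp ha
  simpa using (ly.add_const y').sub tJ

end Convergence

/-! ### Monotone residuals and the gap estimate -/

section Rates

variable {V W : Type*} [NormedAddCommGroup V] [InnerProductSpace ℝ V]
  [NormedAddCommGroup W] [InnerProductSpace ℝ W]
  {K J : V →L[ℝ] W} {Kt : W →L[ℝ] V} {M S : V →L[ℝ] V} {B : W →L[ℝ] W} {ρ α β : ℝ}
  {F : V → Set V} {G : W → Set W} {x : ℕ → V} {y : ℕ → W}

/-- The residual form of a step `(a, b)`. -/
noncomputable def residualForm (K : V →L[ℝ] W) (M S : V →L[ℝ] V) (B : W →L[ℝ] W)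
    (a : V) (b : W) : ℝ :=
  ⟪M a, a⟫ + ⟪S a, a⟫ - 2 * ⟪K a, b⟫ + ⟪B b, b⟫

/-- Young's inequality with weight `(1 + ρ) / 2` on `⟪B b, b⟫`; the weight `2 ρ / (1 + ρ)` left on
the primal form is at most `(1 + ρ) / 2`, because `4 ρ ≤ (1 + ρ)²`. -/
lemma Coupling.coercive_pair (h : Coupling K J Kt M S B ρ α β) (a : V) (b : W) :
    (1 - ρ) / 2 * (⟪M a, a⟫ + 1 / 2 * ⟪S a, a⟫ + ⟪B b, b⟫) ≤
      ⟪M a, a⟫ + 1 / 2 * ⟪S a, a⟫ - 2 * ⟪K a, b⟫ + ⟪B b, b⟫ := by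
  have hρ0 := h.ρ_nonneg
  have h1 := h.B_nonneg (J a - ((1 + ρ) / 2) • b)
  have e1 : ⟪K a, J a⟫ = ⟪B (J a), J a⟫ := by rw [h.B_J]
  have e2 : ⟪B b, J a⟫ = ⟪K a, b⟫ := by rw [h.symm_B, h.B_J, real_inner_comm]
  simp only [map_sub, map_smul, inner_sub_left, inner_sub_right, real_inner_smul_left,
    real_inner_smul_right, h.B_J, e2] at h1
  have h2 := h.le_ρ a
  have h3 := h.A_nonneg a
  have h4 : ρ * (⟪M a, a⟫ + 1 / 2 * ⟪S a, a⟫) ≤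
      ((1 + ρ) / 2) ^ 2 * (⟪M a, a⟫ + 1 / 2 * ⟪S a, a⟫) :=
    mul_le_mul_of_nonneg_right (by nlinarith [sq_nonneg (1 - ρ)]) h3
  have h5 : 0 ≤ (1 + ρ) / 2 * (⟪M a, a⟫ + 1 / 2 * ⟪S a, a⟫ - 2 * ⟪K a, b⟫ + ⟪B b, b⟫ -
      (1 - ρ) / 2 * (⟪M a, a⟫ + 1 / 2 * ⟪S a, a⟫ + ⟪B b, b⟫)) := by
    nlinarith
  have := nonneg_of_mul_nonneg_right h5 (by linarith)
  linarith

/-- The residual form of the steps is nonincreasing if the coupling constant is below one. -/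
lemma residualForm_step_le (h : Coupling K J Kt M S B ρ α β) (hρ : ρ < 1)
    (hF : MonoWith S F) (hG : MonoWith 0 G) (hit : Iterates K Kt M B F G x y) (k : ℕ) :
    residualForm K M S B (x (k + 2) - x (k + 1)) (y (k + 2) - y (k + 1)) ≤
      residualForm K M S B (x (k + 1) - x k) (y (k + 1) - y k) := by
  have p1 := hF _ _ _ _ (hit.primal (k + 1)) (hit.primal k)
  have p2 := hG _ _ _ _ (hit.dual (k + 1)) (hit.dual k)
  have hadj := h.adj
  obtain ⟨a, ha⟩ : ∃ a, a = x (k + 2) - x (k + 1) := ⟨_, rfl⟩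
  obtain ⟨a', ha'⟩ : ∃ a, a = x (k + 1) - x k := ⟨_, rfl⟩
  obtain ⟨b, hb⟩ : ∃ b, b = y (k + 2) - y (k + 1) := ⟨_, rfl⟩
  obtain ⟨b', hb'⟩ : ∃ b, b = y (k + 1) - y k := ⟨_, rfl⟩
  rw [show k + 1 + 1 = k + 2 from rfl] at p1 p2
  rw [← ha, ← hb, ← ha', ← hb']
  rw [← ha, ← ha'] at p1
  rw [← ha, ← ha', ← hb, ← hb'] at p2
  have q1 : ⟪S a, a⟫ ≤ -⟪K a, b'⟫ - ⟪M (a - a'), a⟫ := by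
    have e : ⟪K a, b'⟫ = ⟪Kt b', a⟫ := by rw [hadj, real_inner_comm]
    rw [e]
    refine p1.trans (le_of_eq ?_)
    rw [← inner_neg_left, ← inner_sub_left]
    congr 1
    rw [hb']
    simp only [map_sub]; abel
  have q2 : 0 ≤ ⟪K (a + a - a') - B (b - b'), b⟫ := by
    have e : K (x (k + 2) + a) - B b - (K (x (k + 1) + a') - B b') =
        K (a + a - a') - B (b - b') := by
      rw [ha]
      simp only [map_sub, map_add]; abel
    rw [e] at p2
    simpa using p2
  -- Doubling `q1 + q2` and polarizing leaves the form of `(a - a', b - b')`, with `S` halved, as a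
  -- decrease. The remaining `S`-terms combine to `-½ ⟪S (a + a'), a + a'⟫`.
  have q3 := h.coercive_pair (a - a') (b - b')
  have q4 := mul_nonneg (show 0 ≤ (1 - ρ) / 2 by linarith)
    (add_nonneg (h.A_nonneg (a - a')) (h.B_nonneg (b - b')))
  have q5 := q4.trans q3
  have q6 := h.S_nonneg (a + a')
  have e2 : ⟪M a, a'⟫ = ⟪M a', a⟫ := by rw [h.symm_M, real_inner_comm]
  have e3 : ⟪S a, a'⟫ = ⟪S a', a⟫ := by rw [h.symm_S, real_inner_comm]
  have e4 : ⟪B b, b'⟫ = ⟪B b', b⟫ := by rw [h.symm_B, real_inner_comm]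
  clear q3 q4 p1 p2 ha ha' hb hb'
  unfold residualForm
  simp only [map_sub, map_add, inner_sub_left, inner_sub_right, inner_add_left,
    inner_add_right] at *
  linarith

/-- If the coupling constant is below one, then the steps are `o(1/√t)`. -/
lemma exists_rate_of_lt_one (h : Coupling K J Kt M S B ρ α β) (hρ : ρ < 1)
    (hF : MonoWith S F) (hG : MonoWith 0 G) (hit : Iterates K Kt M B F G x y)
    {xs : V} {ys : W} (hs : IsKKT K Kt F G xs ys) :
    ∃ μ : ℕ → ℝ, IsLittleOInvSqrt μ ∧ ∀ t, ‖x (t + 1) - x t‖ + ‖y (t + 1) - y t‖ ≤ μ t := by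
  obtain ⟨hsa, hsb⟩ := summable_steps h (by linarith) hF hG hit hs
  set P : ℕ → ℝ := fun k => residualForm K M S B (x (k + 1) - x k) (y (k + 1) - y k) with hP
  have hlow : ∀ k, (1 - ρ) / 2 * (α * ‖x (k + 1) - x k‖ ^ 2 + β * ‖y (k + 1) - y k‖ ^ 2) ≤ P k := by
    intro k
    have h1 := h.coercive_pair (x (k + 1) - x k) (y (k + 1) - y k)
    have h2 := h.S_nonneg (x (k + 1) - x k)
    have h3 := mul_le_mul_of_nonneg_left
      (add_le_add (h.coercive_A (x (k + 1) - x k)) (h.coercive_B (y (k + 1) - y k)))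
      (show 0 ≤ (1 - ρ) / 2 by linarith)
    simp only [hP, residualForm]
    linarith
  have hP0 : ∀ k, 0 ≤ P k := fun k => le_trans (mul_nonneg (by linarith)
    (add_nonneg (mul_nonneg h.α_pos.le (sq_nonneg _)) (mul_nonneg h.β_pos.le (sq_nonneg _))))
    (hlow k)
  have hupp : ∀ k, P k ≤ (‖M‖ + ‖S‖ + ‖K‖) * ‖x (k + 1) - x k‖ ^ 2 +
      (‖B‖ + ‖K‖) * ‖y (k + 1) - y k‖ ^ 2 := by
    intro k
    set a := x (k + 1) - x k
    set b := y (k + 1) - y k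
    have h1 := (le_abs_self _).trans ((abs_real_inner_le_norm (M a) a).trans
      (mul_le_mul_of_nonneg_right (M.le_opNorm a) (norm_nonneg _)))
    have h2 := (le_abs_self _).trans ((abs_real_inner_le_norm (S a) a).trans
      (mul_le_mul_of_nonneg_right (S.le_opNorm a) (norm_nonneg _)))
    have h3 := (neg_abs_le _).trans' (neg_le_neg ((abs_real_inner_le_norm (K a) b).trans
      (mul_le_mul_of_nonneg_right (K.le_opNorm a) (norm_nonneg _))))
    have h4 := (le_abs_self _).trans ((abs_real_inner_le_norm (B b) b).trans
      (mul_le_mul_of_nonneg_right (B.le_opNorm b) (norm_nonneg _)))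
    have h5 := mul_nonneg (norm_nonneg K) (sq_nonneg (‖a‖ - ‖b‖))
    simp only [hP, residualForm]
    nlinarith
  have hPs : Summable P := Summable.of_nonneg_of_le hP0 hupp
    ((hsa.mul_left _).add (hsb.mul_left _))
  have hPanti : Antitone P := antitone_nat_of_succ_le (residualForm_step_le h hρ hF hG hit)
  have hμ : IsLittleOInvSqrt (fun t => √(P t)) :=
    -- By monotonicity `P t` is the least of the first `t` values.
    isLittleOInvSqrt_of_le_summable hP0 hPs (fun _ => Real.sqrt_nonneg _) fun t j _ hjt => by
      rw [Real.sq_sqrt (hP0 t)]; exact hPanti hjt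
  obtain ⟨γ, hγ, hγa, hγb⟩ : ∃ γ, 0 < γ ∧ γ ≤ (1 - ρ) / 2 * α ∧ γ ≤ (1 - ρ) / 2 * β :=
    ⟨min ((1 - ρ) / 2 * α) ((1 - ρ) / 2 * β),
      lt_min (mul_pos (by linarith) h.α_pos) (mul_pos (by linarith) h.β_pos),
      min_le_left _ _, min_le_right _ _⟩
  refine ⟨fun t => √(2 / γ) * √(P t), hμ.const_mul_left _, fun t => ?_⟩
  dsimp only
  rw [← Real.sqrt_mul (by positivity)]
  refine Real.le_sqrt_of_sq_le ?_
  rw [div_mul_eq_mul_div, le_div_iff₀ hγ]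
  have h1 := hlow t
  have h2 := mul_le_mul_of_nonneg_right hγa (sq_nonneg ‖x (t + 1) - x t‖)
  have h3 := mul_le_mul_of_nonneg_right hγb (sq_nonneg ‖y (t + 1) - y t‖)
  have h4 := mul_nonneg hγ.le (sq_nonneg (‖x (t + 1) - x t‖ - ‖y (t + 1) - y t‖))
  nlinarith

/-- Bound on the sum of the subgradient estimates that controls the primal-dual gap at the iterate
`k ≥ 1` by the length of the step from `k` to `k + 1`. -/
lemma exists_gap_bound (hadj : ∀ u w, ⟪K u, w⟫ = ⟪u, Kt w⟫)
    {x' : V} {y' : W} (hx : Tendsto x atTop (𝓝 x')) (hy : Tendsto y atTop (𝓝 y'))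
    {c : ℝ} (hc : ∀ k, ‖x k - x'‖ + ‖y k - y'‖ ≤ c) :
    ∃ C, 0 ≤ C ∧ ∀ k u v,
      -⟪-Kt (y k) - M (x (k + 1) - x k), x (k + 2) - x (k + 1)⟫ +
      ⟪-Kt (y (k + 1)) - M (x (k + 2) - x (k + 1)), x (k + 2) - u⟫ -
      ⟪K (x (k + 1) + (x (k + 1) - x k)) - B (y (k + 1) - y k), y (k + 2) - y (k + 1)⟫ +
      ⟪K (x (k + 2) + (x (k + 2) - x (k + 1))) - B (y (k + 2) - y (k + 1)), y (k + 2) - v⟫ +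
      ⟪K (x (k + 1)), v⟫ - ⟪K u, y (k + 1)⟫ ≤
        C * (‖x (k + 2) - x (k + 1)‖ + ‖y (k + 2) - y (k + 1)‖) *
          (c + ‖x' - u‖ + ‖y' - v‖) := by
  have hx1 := (tendsto_add_atTop_iff_nat 1).2 hx
  have hx2 := (tendsto_add_atTop_iff_nat 2).2 hx
  have hy1 := (tendsto_add_atTop_iff_nat 1).2 hy
  have hξ : Tendsto (fun k => -Kt (y k) - M (x (k + 1) - x k)) atTop
      (𝓝 (-Kt y' - M (x' - x'))) :=
    ((Kt.continuous.tendsto _).comp hy).neg.sub ((M.continuous.tendsto _).comp (hx1.sub hx))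
  have hη : Tendsto (fun k => K (x (k + 2)) -
      (K (x (k + 1) + (x (k + 1) - x k)) - B (y (k + 1) - y k))) atTop
      (𝓝 (K x' - (K (x' + (x' - x')) - B (y' - y')))) :=
    ((K.continuous.tendsto _).comp hx2).sub
      (((K.continuous.tendsto _).comp (hx1.add (hx1.sub hx))).sub
        ((B.continuous.tendsto _).comp (hy1.sub hy)))
  obtain ⟨R₁, hR₁⟩ := hξ.norm.bddAbove_range
  obtain ⟨R₂, hR₂⟩ := hη.norm.bddAbove_range
  have hc0 : 0 ≤ c := (add_nonneg (norm_nonneg _) (norm_nonneg _)).trans (hc 0)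
  obtain ⟨R, hR0, hR1, hR2, hR3⟩ : ∃ R, 0 ≤ R ∧ R₁ ≤ R ∧ R₂ ≤ R ∧ ‖K‖ * ‖y'‖ ≤ R :=
    ⟨max (max R₁ R₂) (‖K‖ * ‖y'‖), le_trans (by positivity) (le_max_right _ _),
      (le_max_left _ _).trans (le_max_left _ _), (le_max_right _ _).trans (le_max_left _ _),
      le_max_right _ _⟩
  -- Three of the terms are bounded by `R` times a step, without the distance factor; dividing by
  -- `c`, which is at most that factor, puts them into the required form.
  refine ⟨2 * R / c + (2 * ‖K‖ + ‖M‖ + ‖B‖), by positivity, fun k u v => ?_⟩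
  have hξk : ‖-Kt (y k) - M (x (k + 1) - x k)‖ ≤ R := (hR₁ ⟨k, rfl⟩).trans hR1
  have hηk : ‖K (x (k + 2)) - (K (x (k + 1) + (x (k + 1) - x k)) - B (y (k + 1) - y k))‖ ≤ R :=
    (hR₂ ⟨k, rfl⟩).trans hR2
  obtain ⟨ξ, hξe⟩ : ∃ ξ, ξ = -Kt (y k) - M (x (k + 1) - x k) := ⟨_, rfl⟩
  obtain ⟨η, hηe⟩ : ∃ η, η = K (x (k + 1) + (x (k + 1) - x k)) - B (y (k + 1) - y k) := ⟨_, rfl⟩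
  obtain ⟨a, ha⟩ : ∃ a, a = x (k + 2) - x (k + 1) := ⟨_, rfl⟩
  obtain ⟨b, hb⟩ : ∃ b, b = y (k + 2) - y (k + 1) := ⟨_, rfl⟩
  rw [← hξe] at hξk
  rw [← hηe] at hηk
  rw [← hξe, ← hηe, ← ha, ← hb]
  have hxk := hc (k + 2)
  have hyk : ‖y (k + 2) - y'‖ ≤ c := (le_add_of_nonneg_left (norm_nonneg _)).trans hxk
  replace hxk : ‖x (k + 2) - x'‖ ≤ c := (le_add_of_nonneg_right (norm_nonneg _)).trans hxk
  obtain ⟨D, hD⟩ : ∃ D, D = c + ‖x' - u‖ + ‖y' - v‖ := ⟨_, rfl⟩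
  have hD0 : 0 ≤ D := by rw [hD]; positivity
  have hcD : c ≤ D := by rw [hD]; linarith [norm_nonneg (x' - u), norm_nonneg (y' - v)]
  have hxu : ‖x (k + 2) - u‖ ≤ D := by
    have := norm_sub_le_norm_sub_add_norm_sub (x (k + 2)) x' u
    rw [hD]; linarith [norm_nonneg (y' - v)]
  have hyv : ‖y (k + 2) - v‖ ≤ D := by
    have := norm_sub_le_norm_sub_add_norm_sub (y (k + 2)) y' v
    rw [hD]; linarith [norm_nonneg (x' - u)]
  have hyv' : ‖y' - v‖ ≤ D := by rw [hD]; linarith [norm_nonneg (x' - u)]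
  rw [← hD]
  have key : -⟪ξ, a⟫ + ⟪-Kt (y (k + 1)) - M a, x (k + 2) - u⟫ - ⟪η, b⟫ +
      ⟪K (x (k + 2) + a) - B b, y (k + 2) - v⟫ + ⟪K (x (k + 1)), v⟫ - ⟪K u, y (k + 1)⟫ =
      ⟪-ξ, a⟫ + ⟪K (x (k + 2)) - η, b⟫ + ⟪-K a, y'⟫ + ⟪K a, y' - v⟫ + ⟪-M a, x (k + 2) - u⟫ +
        ⟪K a, y (k + 2) - v⟫ + ⟪-B b, y (k + 2) - v⟫ := by
    have e1 : x (k + 1) = x (k + 2) - a := by rw [ha]; abel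
    have e2 : y (k + 1) = y (k + 2) - b := by rw [hb]; abel
    have e3 : ∀ w z, ⟪Kt w, z⟫ = ⟪K z, w⟫ := fun w z => by rw [hadj, real_inner_comm]
    rw [e1, e2]
    simp only [inner_sub_left, inner_sub_right, inner_add_left, inner_neg_left, map_sub, map_add,
      e3]
    ring
  rw [key]
  have t1 : ⟪-ξ, a⟫ ≤ R * ‖a‖ := (real_inner_le_norm _ _).trans
    (mul_le_mul_of_nonneg_right (by rwa [norm_neg]) (norm_nonneg _))
  have t2 : ⟪K (x (k + 2)) - η, b⟫ ≤ R * ‖b‖ := (real_inner_le_norm _ _).trans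
    (mul_le_mul_of_nonneg_right hηk (norm_nonneg _))
  have t3 : ⟪-K a, y'⟫ ≤ R * ‖a‖ := (real_inner_le_norm _ _).trans (by
    rw [norm_neg]
    nlinarith [K.le_opNorm a, norm_nonneg a, norm_nonneg y',
      mul_le_mul_of_nonneg_right (K.le_opNorm a) (norm_nonneg y'),
      mul_le_mul_of_nonneg_right hR3 (norm_nonneg a)])
  have t4 : ⟪K a, y' - v⟫ ≤ ‖K‖ * ‖a‖ * D := (real_inner_le_norm _ _).trans
    (mul_le_mul (K.le_opNorm a) hyv' (norm_nonneg _) (by positivity))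
  have t5 : ⟪-M a, x (k + 2) - u⟫ ≤ ‖M‖ * ‖a‖ * D := (real_inner_le_norm _ _).trans
    (mul_le_mul (by rw [norm_neg]; exact M.le_opNorm a) hxu (norm_nonneg _) (by positivity))
  have t6 : ⟪K a, y (k + 2) - v⟫ ≤ ‖K‖ * ‖a‖ * D := (real_inner_le_norm _ _).trans
    (mul_le_mul (K.le_opNorm a) hyv (norm_nonneg _) (by positivity))
  have t7 : ⟪-B b, y (k + 2) - v⟫ ≤ ‖B‖ * ‖b‖ * D := (real_inner_le_norm _ _).trans
    (mul_le_mul (by rw [norm_neg]; exact B.le_opNorm b) hyv (norm_nonneg _) (by positivity))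
  have t8 : 2 * R * (‖a‖ + ‖b‖) ≤ 2 * R / c * (‖a‖ + ‖b‖) * D := by
    -- If `c = 0`, the sequence is constant and both steps vanish, so the value `2 * R / 0 = 0` does
    -- no harm.
    rcases hc0.eq_or_lt with h0 | hpos
    · have hz : ∀ j, x j = x' ∧ y j = y' := fun j => by
        have h1 := hc j
        rw [← h0] at h1
        have h2 := norm_nonneg (x j - x')
        have h3 := norm_nonneg (y j - y')
        exact ⟨sub_eq_zero.1 (norm_eq_zero.1 (by linarith)),
          sub_eq_zero.1 (norm_eq_zero.1 (by linarith))⟩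
      have ha0 : a = 0 := by rw [ha, (hz _).1, (hz _).1, sub_self]
      have hb0 : b = 0 := by rw [hb, (hz _).2, (hz _).2, sub_self]
      simp only [ha0, hb0, norm_zero, add_zero, mul_zero, zero_mul, le_refl]
    · have h1 : 2 * R / c * (‖a‖ + ‖b‖) * c ≤ 2 * R / c * (‖a‖ + ‖b‖) * D :=
        mul_le_mul_of_nonneg_left hcD (by positivity)
      refine le_trans (le_of_eq ?_) h1
      field_simp
  have s1 := mul_nonneg (mul_nonneg (norm_nonneg K) (norm_nonneg b)) hD0
  have s2 := mul_nonneg (mul_nonneg (norm_nonneg M) (norm_nonneg b)) hD0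
  have s3 := mul_nonneg (mul_nonneg (norm_nonneg B) (norm_nonneg a)) hD0
  have s4 := mul_nonneg hR0 (norm_nonneg b)
  nlinarith

end Rates

/-! ### Extended-valued convex analysis and saddle points -/

section Convex

lemma coe_sub_top (r : ℝ) : (r : EReal) - ⊤ = ⊥ := by
  rw [sub_eq_add_neg, EReal.neg_top, EReal.add_bot]

lemma ProperClosedConvex.exists_real {n : ℕ} {f : E n → EReal} (hf : ProperClosedConvex f)
    {x : E n} (hx : f x ≠ ⊤) : ∃ r : ℝ, f x = r :=
  ⟨(f x).toReal, (EReal.coe_toReal hx (hf.ne_bot x)).symm⟩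

lemma ProperClosedConvex.ne_top_of_le {n : ℕ} {f : E n → EReal} (hf : ProperClosedConvex f)
    {x : E n} {s : E n → ℝ} (h : ∀ z, f x + (s z : EReal) ≤ f z) : f x ≠ ⊤ := by
  intro hx
  obtain ⟨z, hz⟩ := hf.exists_finite
  have := h z
  rw [hx, EReal.top_add_coe, top_le_iff] at this
  exact hz this

lemma ProperClosedConvex.subdiff_ne_top {n : ℕ} {f : E n → EReal} (hf : ProperClosedConvex f)
    {x ξ : E n} (h : ξ ∈ subdiff f x) : f x ≠ ⊤ :=
  hf.ne_top_of_le h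

lemma ProperClosedConvex.isClosed_epi {n : ℕ} {f : E n → EReal} (hf : ProperClosedConvex f) :
    IsClosed {p : E n × ℝ | f p.1 ≤ (p.2 : EReal)} :=
  hf.closed.isClosed_epigraph.preimage
    (f := fun p : E n × ℝ => (p.1, (p.2 : EReal)))
    (continuous_fst.prodMk (continuous_coe_real_ereal.comp continuous_snd))

/-- A proper closed convex function has an affine minorant. -/
lemma ProperClosedConvex.exists_affine_le {n : ℕ} {f : E n → EReal} (hf : ProperClosedConvex f) :
    ∃ (ξ : E n) (c : ℝ), ∀ z, ((⟪z, ξ⟫ - c : ℝ) : EReal) ≤ f z := by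
  obtain ⟨x₀, hx₀⟩ := hf.exists_finite
  obtain ⟨r₀, hr₀⟩ := hf.exists_real hx₀
  have hnot : (x₀, r₀ - 1) ∉ {p : E n × ℝ | f p.1 ≤ (p.2 : EReal)} := by
    simp only [Set.mem_ofPred_eq, hr₀, EReal.coe_le_coe_iff]
    linarith
  obtain ⟨l, u, hlt, hgt⟩ := geometric_hahn_banach_point_closed hf.convex hf.isClosed_epi hnot
  have hdec : ∀ (z : E n) (r : ℝ), l (z, r) = l (z, 0) + r * l (0, 1) := fun z r => by
    have : (z, r) = (z, (0 : ℝ)) + r • ((0 : E n), (1 : ℝ)) := by simp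
    rw [this, map_add, map_smul, smul_eq_mul]
  -- The separated point lies directly below an epigraph point, so the hyperplane is not vertical.
  have hb : 0 < l (0, 1) := by
    have h1 := hgt (x₀, r₀) (by simp [hr₀])
    rw [hdec] at hlt h1
    nlinarith
  let ℓ : E n →L[ℝ] ℝ := l.comp (ContinuousLinearMap.inl ℝ (E n) ℝ)
  refine ⟨-((l (0, 1))⁻¹ • (InnerProductSpace.toDual ℝ (E n)).symm ℓ), -(l (0, 1))⁻¹ * u,
    fun z => ?_⟩
  by_cases hz : f z = ⊤
  · rw [hz]; exact le_top
  obtain ⟨r, hr⟩ := hf.exists_real hz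
  rw [hr, EReal.coe_le_coe_iff]
  have h1 := hgt (z, r) (by simp [hr])
  rw [hdec] at h1
  have h2 : ⟪z, (InnerProductSpace.toDual ℝ (E n)).symm ℓ⟫ = l (z, 0) := by
    rw [real_inner_comm, InnerProductSpace.toDual_symm_apply]
    simp [ℓ]
  rw [inner_neg_right, real_inner_smul_right, h2]
  have h3 := mul_lt_mul_of_pos_left h1 (inv_pos.2 hb)
  rw [mul_add, mul_comm r, inv_mul_cancel_left₀ hb.ne'] at h3
  linarith

/-- The conjugate of a proper closed convex function is proper, closed and convex. -/
lemma ProperClosedConvex.conj {m : ℕ} {g : E m → EReal} (hg : ProperClosedConvex g) :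
    ProperClosedConvex (conj g) where
  ne_bot y := by
    obtain ⟨z, hz⟩ := hg.exists_finite
    obtain ⟨r, hr⟩ := hg.exists_real hz
    have h : ((⟪z, y⟫ : ℝ) : EReal) - g z ≤ PrePDHG.conj g y :=
      le_iSup (fun z : E m => ((⟪z, y⟫ : ℝ) : EReal) - g z) z
    rw [hr, ← EReal.coe_sub] at h
    exact ((EReal.bot_lt_coe _).trans_le h).ne'
  exists_finite := by
    obtain ⟨ξ, c, h⟩ := hg.exists_affine_le
    refine ⟨ξ, ((?_ : PrePDHG.conj g ξ ≤ (c : EReal)).trans_lt (EReal.coe_lt_top c)).ne⟩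
    refine iSup_le fun z => ?_
    by_cases hz : g z = ⊤
    · rw [hz, coe_sub_top]; exact bot_le
    obtain ⟨r, hr⟩ := hg.exists_real hz
    have := h z
    rw [hr, EReal.coe_le_coe_iff] at this
    rw [hr, ← EReal.coe_sub, EReal.coe_le_coe_iff]
    linarith
  closed := by
    refine lowerSemicontinuous_iSup fun z => ?_
    by_cases hz : g z = ⊤
    · simp only [hz, coe_sub_top]; exact lowerSemicontinuous_const
    obtain ⟨r, hr⟩ := hg.exists_real hz
    simp only [hr, ← EReal.coe_sub]
    exact (continuous_coe_real_ereal.comp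
      ((continuous_const.inner continuous_id).sub continuous_const)).lowerSemicontinuous
  convex := by
    intro p hp q hq a b ha hb hab
    refine show PrePDHG.conj g _ ≤ _ from iSup_le fun z => ?_
    by_cases hz : g z = ⊤
    · rw [hz, coe_sub_top]; exact bot_le
    obtain ⟨r, hr⟩ := hg.exists_real hz
    have h1 : ((⟪z, p.1⟫ : ℝ) : EReal) - g z ≤ p.2 :=
      (le_iSup (fun z : E m => ((⟪z, p.1⟫ : ℝ) : EReal) - g z) z).trans hp
    have h2 : ((⟪z, q.1⟫ : ℝ) : EReal) - g z ≤ q.2 :=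
      (le_iSup (fun z : E m => ((⟪z, q.1⟫ : ℝ) : EReal) - g z) z).trans hq
    rw [hr, ← EReal.coe_sub, EReal.coe_le_coe_iff] at h1 h2 ⊢
    simp only [Prod.fst_add, Prod.smul_fst, Prod.snd_add, Prod.smul_snd, inner_add_right,
      real_inner_smul_right, smul_eq_mul]
    have h3 : r = a * r + b * r := by rw [← add_mul, hab, one_mul]
    nlinarith [mul_le_mul_of_nonneg_left h1 ha, mul_le_mul_of_nonneg_left h2 hb]

lemma ProperClosedConvex.subdiff_real {n : ℕ} {f : E n → EReal} (hf : ProperClosedConvex f)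
    {x ξ : E n} (h : ξ ∈ subdiff f x) : ∃ r : ℝ, f x = r ∧
      ∀ (z : E n) (s : ℝ), f z ≤ s → r + ⟪ξ, z - x⟫ ≤ s := by
  obtain ⟨r, hr⟩ := hf.exists_real (hf.subdiff_ne_top h)
  refine ⟨r, hr, fun z s hs => ?_⟩
  have := (h z).trans hs
  rwa [hr, ← EReal.coe_add, EReal.coe_le_coe_iff] at this

/-- For a fixed `z` in the domain, the subgradient inequality says that a point depending
continuously on `(x, ξ)` lies in the epigraph, which is closed. -/
lemma ProperClosedConvex.closedGraph_subdiff {n : ℕ} {f : E n → EReal}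
    (hf : ProperClosedConvex f) : ClosedGraph (subdiff f) := by
  intro x ξ x' ξ' h hx hξ z
  by_cases hz : f z = ⊤
  · rw [hz]; exact le_top
  obtain ⟨s, hs⟩ := hf.exists_real hz
  have hmem : ∀ k, (x k, s - ⟪ξ k, z - x k⟫) ∈ {p : E n × ℝ | f p.1 ≤ (p.2 : EReal)} := fun k => by
    obtain ⟨r, hr, hr'⟩ := hf.subdiff_real (h k)
    have := hr' z s hs.le
    simp only [Set.mem_ofPred_eq, hr, EReal.coe_le_coe_iff]
    linarith
  have hlim : Tendsto (fun k => (x k, s - ⟪ξ k, z - x k⟫)) atTop (𝓝 (x', s - ⟪ξ', z - x'⟫)) :=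
    hx.prodMk_nhds ((hξ.inner (hx.const_sub z)).const_sub s)
  have h1 : f x' ≤ ((s - ⟪ξ', z - x'⟫ : ℝ) : EReal) :=
    hf.isClosed_epi.mem_of_tendsto hlim (Eventually.of_forall hmem)
  obtain ⟨r, hr⟩ := hf.exists_real (h1.trans_lt (EReal.coe_lt_top _)).ne
  rw [hr, EReal.coe_le_coe_iff] at h1
  rw [hr, hs, ← EReal.coe_add, EReal.coe_le_coe_iff]
  linarith

lemma ProperClosedConvex.monotone_subdiff {n : ℕ} {f : E n → EReal}
    (hf : ProperClosedConvex f) : MonoWith 0 (subdiff f) := by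
  intro x₁ x₂ ξ₁ ξ₂ h₁ h₂
  obtain ⟨r₁, e₁, h₁⟩ := hf.subdiff_real h₁
  obtain ⟨r₂, e₂, h₂⟩ := hf.subdiff_real h₂
  have a := h₁ x₂ r₂ e₂.le
  have b := h₂ x₁ r₁ e₁.le
  have e : x₂ - x₁ = -(x₁ - x₂) := by abel
  rw [e, inner_neg_right] at a
  rw [inner_sub_left]
  simp only [zero_apply, inner_zero_left]
  linarith

/-- First-order optimality condition for the sum of a proper closed convex function and a possibly
nonconvex quadratic function. -/
lemma ProperClosedConvex.subdiff_of_isMinOn {n : ℕ} {f : E n → EReal}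
    (hf : ProperClosedConvex f) (M : E n →L[ℝ] E n) (hM : ∀ u v, ⟪M u, v⟫ = ⟪u, M v⟫)
    (c x₀ x : E n)
    (h : ∀ z, f x + ((⟪c, x⟫ + 1 / 2 * ⟪M (x - x₀), x - x₀⟫ : ℝ) : EReal) ≤
      f z + ((⟪c, z⟫ + 1 / 2 * ⟪M (z - x₀), z - x₀⟫ : ℝ) : EReal)) :
    -c - M (x - x₀) ∈ subdiff f x := by
  have hx : f x ≠ ⊤ := by
    intro hx
    obtain ⟨z, hz⟩ := hf.exists_finite
    obtain ⟨r, hr⟩ := hf.exists_real hz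
    have := h z
    rw [hx, EReal.top_add_coe, hr, ← EReal.coe_add, top_le_iff] at this
    exact EReal.coe_ne_top _ this
  obtain ⟨r, hr⟩ := hf.exists_real hx
  intro z
  by_cases hz : f z = ⊤
  · rw [hz]; exact le_top
  obtain ⟨s, hs⟩ := hf.exists_real hz
  rw [hr, hs, ← EReal.coe_add, EReal.coe_le_coe_iff]
  obtain ⟨q, hq⟩ : ∃ q, q = ⟪M (z - x), z - x⟫ := ⟨_, rfl⟩
  -- Comparison with `x + t (z - x)`, divided by `t`. The quadratic is of second order in `t`, so
  -- its sign is irrelevant in the limit.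
  have key : ∀ t : ℝ, 0 < t → t ≤ 1 → 0 ≤ s - r + ⟪c + M (x - x₀), z - x⟫ + t * (1 / 2 * q) := by
    intro t ht ht1
    have hconv := hf.convex (show (x, r) ∈ _ from hr.le) (show (z, s) ∈ _ from hs.le)
      (sub_nonneg.2 ht1) ht.le (by ring)
    have hle : f (x + t • (z - x)) ≤ (((1 - t) * r + t * s : ℝ) : EReal) := by
      have e : x + t • (z - x) = (1 - t) • x + t • z := by module
      rw [e]; exact hconv
    have h1 := (h (x + t • (z - x))).trans (add_le_add_left hle _)
    rw [hr, ← EReal.coe_add, ← EReal.coe_add, EReal.coe_le_coe_iff] at h1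
    have e1 : x + t • (z - x) - x₀ = (x - x₀) + t • (z - x) := by abel
    have e2 : ⟪M (z - x), x - x₀⟫ = ⟪M (x - x₀), z - x⟫ := by rw [hM, real_inner_comm]
    rw [e1, map_add, map_smul, inner_add_left, inner_add_right, inner_add_right, inner_add_right,
      real_inner_smul_left, real_inner_smul_left, real_inner_smul_right, real_inner_smul_right,
      real_inner_smul_right, e2, ← hq] at h1
    rw [inner_add_left]
    have h2 : 0 ≤ t * (s - r + (⟪c, z - x⟫ + ⟪M (x - x₀), z - x⟫) + t * (1 / 2 * q)) := by
      linarith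
    exact nonneg_of_mul_nonneg_right h2 ht
  have hlim : Tendsto (fun t : ℝ => s - r + ⟪c + M (x - x₀), z - x⟫ + t * (1 / 2 * q)) (𝓝[>] 0)
      (𝓝 (s - r + ⟪c + M (x - x₀), z - x⟫)) := by
    have : Continuous (fun t : ℝ => s - r + ⟪c + M (x - x₀), z - x⟫ + t * (1 / 2 * q)) := by
      fun_prop
    have h0 := (this.tendsto 0).mono_left (nhdsWithin_le_nhds (s := Set.Ioi 0))
    simpa only [zero_mul, add_zero] using h0
  have hfin := ge_of_tendsto hlim (by
    filter_upwards [Ioc_mem_nhdsGT (show (0 : ℝ) < 1 by norm_num)] with t ht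
    exact key t ht.1 ht.2)
  have e : -c - M (x - x₀) = -(c + M (x - x₀)) := by abel
  rw [e, inner_neg_left]
  linarith

/-- Subgradient-type estimates of `f` and `g*` bound the primal-dual gap. -/
lemma lagr_sub_le {n m : ℕ} {K : Matrix (Fin m) (Fin n) ℝ} {f : E n → EReal} {g : E m → EReal}
    (hf : ProperClosedConvex f) (hg : ProperClosedConvex (conj g)) {x u : E n} {y v : E m}
    {r s p q T : ℝ} (hr : f x = r) (hs : conj g y = s)
    (hp : ∀ t : ℝ, f u = t → r ≤ t + p) (hq : ∀ t : ℝ, conj g v = t → s ≤ t + q)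
    (hT : p + q + ⟪mv K x, v⟫ - ⟪mv K u, y⟫ ≤ T) :
    lagr K f g x v - lagr K f g u y ≤ (T : EReal) := by
  unfold lagr
  rw [hr, hs]
  by_cases hv : conj g v = ⊤
  · rw [hv, ← EReal.coe_add, coe_sub_top, EReal.bot_sub]; exact bot_le
  obtain ⟨t, ht⟩ := hg.exists_real hv
  rw [ht]
  by_cases hu : f u = ⊤
  · rw [hu, EReal.top_add_coe, EReal.top_sub_coe, ← EReal.coe_add, ← EReal.coe_sub,
      coe_sub_top]
    exact bot_le
  obtain ⟨t', ht'⟩ := hf.exists_real hu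
  rw [ht', ← EReal.coe_add, ← EReal.coe_sub, ← EReal.coe_add, ← EReal.coe_sub, ← EReal.coe_sub,
    EReal.coe_le_coe_iff]
  linarith [hp t' ht', hq t ht]

/-- With `x₀`, `y₀` in the domains, `L(xs, ys)` lies between `L(xs, y₀) > -∞` and `L(x₀, ys) < +∞`.
The convention `⊤ - ⊤ = ⊥` makes it necessary to treat `f xs` before `g* ys`. -/
lemma IsSaddlePoint.finite {n m : ℕ} {K : Matrix (Fin m) (Fin n) ℝ} {f : E n → EReal}
    {g : E m → EReal} (hf : ProperClosedConvex f) (hg : ProperClosedConvex (conj g))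
    {xs : E n} {ys : E m} (h : IsSaddlePoint K f g xs ys) : f xs ≠ ⊤ ∧ conj g ys ≠ ⊤ := by
  obtain ⟨x₀, hx₀⟩ := hf.exists_finite
  obtain ⟨y₀, hy₀⟩ := hg.exists_finite
  obtain ⟨r₀, hr₀⟩ := hf.exists_real hx₀
  obtain ⟨s₀, hs₀⟩ := hg.exists_real hy₀
  have h1 := h.1 y₀
  have h2 := h1.trans (h.2 x₀)
  unfold lagr at h1 h2
  rw [hs₀] at h1 h2
  rw [hr₀] at h2
  have hx : f xs ≠ ⊤ := by
    intro hx
    rw [hx, EReal.top_add_coe, EReal.top_sub_coe, top_le_iff, ← EReal.coe_add] at h2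
    by_cases hy : conj g ys = ⊤
    · rw [hy, coe_sub_top] at h2
      exact bot_ne_top h2
    · obtain ⟨s, hs⟩ := hg.exists_real hy
      rw [hs, ← EReal.coe_sub] at h2
      exact EReal.coe_ne_top _ h2
  refine ⟨hx, fun hy => ?_⟩
  obtain ⟨r, hr⟩ := hf.exists_real hx
  rw [hr, hy, ← EReal.coe_add, ← EReal.coe_sub, ← EReal.coe_add, coe_sub_top, le_bot_iff] at h1
  exact EReal.coe_ne_bot _ h1

/-- Saddle points of the Lagrangian are the KKT points. -/
lemma isSaddlePoint_iff_isKKT {n m : ℕ} {K : Matrix (Fin m) (Fin n) ℝ} {f : E n → EReal}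
    {g : E m → EReal} (hf : ProperClosedConvex f) (hg : ProperClosedConvex (conj g))
    {KL : E n →L[ℝ] E m} {Kt : E m →L[ℝ] E n} (hK : ∀ u, KL u = mv K u)
    (hadj : ∀ u w, ⟪KL u, w⟫ = ⟪u, Kt w⟫) {xs : E n} {ys : E m} :
    IsSaddlePoint K f g xs ys ↔ IsKKT KL Kt (subdiff f) (subdiff (conj g)) xs ys := by
  constructor
  · intro h
    obtain ⟨hx, hy⟩ := h.finite hf hg
    obtain ⟨r, hr⟩ := hf.exists_real hx
    obtain ⟨s, hs⟩ := hg.exists_real hy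
    constructor
    · intro z
      by_cases hz : f z = ⊤
      · rw [hz]; exact le_top
      obtain ⟨t, ht⟩ := hf.exists_real hz
      have h2 := h.2 z
      unfold lagr at h2
      rw [hr, hs, ht, ← EReal.coe_add, ← EReal.coe_sub, ← EReal.coe_add, ← EReal.coe_sub,
        EReal.coe_le_coe_iff, ← hK, ← hK] at h2
      rw [hr, ht, ← EReal.coe_add, EReal.coe_le_coe_iff, inner_neg_left, real_inner_comm, ← hadj,
        map_sub, inner_sub_left]
      linarith
    · intro z
      by_cases hz : conj g z = ⊤
      · rw [hz]; exact le_top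
      obtain ⟨t, ht⟩ := hg.exists_real hz
      have h2 := h.1 z
      unfold lagr at h2
      rw [hr, hs, ht, ← EReal.coe_add, ← EReal.coe_sub, ← EReal.coe_add, ← EReal.coe_sub,
        EReal.coe_le_coe_iff, ← hK] at h2
      rw [hs, ht, ← EReal.coe_add, EReal.coe_le_coe_iff, inner_sub_right]
      linarith
  · rintro ⟨h1, h2⟩
    obtain ⟨r, hr, h1⟩ := hf.subdiff_real h1
    obtain ⟨s, hs, h2⟩ := hg.subdiff_real h2
    constructor
    · intro z
      unfold lagr
      rw [hr, hs]
      by_cases hz : conj g z = ⊤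
      · rw [hz, ← EReal.coe_add, coe_sub_top]; exact bot_le
      obtain ⟨t, ht⟩ := hg.exists_real hz
      have := h2 z t ht.le
      rw [ht, ← EReal.coe_add, ← EReal.coe_sub, ← EReal.coe_add, ← EReal.coe_sub,
        EReal.coe_le_coe_iff, ← hK]
      rw [inner_sub_right] at this
      linarith
    · intro z
      unfold lagr
      rw [hr, hs]
      by_cases hz : f z = ⊤
      · rw [hz, EReal.top_add_coe, EReal.top_sub_coe]; exact le_top
      obtain ⟨t, ht⟩ := hf.exists_real hz
      have := h1 z t ht.le
      rw [ht, ← EReal.coe_add, ← EReal.coe_sub, ← EReal.coe_add, ← EReal.coe_sub,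
        EReal.coe_le_coe_iff, ← hK, ← hK]
      rw [inner_neg_left, real_inner_comm, ← hadj, map_sub, inner_sub_left] at this
      linarith

end Convex

/-! ### From matrices to operators -/

section Matrices

/-- The continuous linear map of a matrix. -/
noncomputable def mvL {m n : ℕ} (A : Matrix (Fin m) (Fin n) ℝ) : E n →L[ℝ] E m :=
  LinearMap.toContinuousLinearMap (Matrix.toEuclideanLin A)

lemma mvL_apply {m n : ℕ} (A : Matrix (Fin m) (Fin n) ℝ) (x : E n) : mvL A x = mv A x := rfl

lemma norm_mvL {m n : ℕ} (A : Matrix (Fin m) (Fin n) ℝ) : ‖mvL A‖ = ‖A‖ := rfl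

lemma mvL_mul {l m n : ℕ} (A : Matrix (Fin l) (Fin m) ℝ) (B : Matrix (Fin m) (Fin n) ℝ)
    (x : E n) : mvL (A * B) x = mvL A (mvL B x) := by
  simp [mvL, Matrix.toLpLin_apply, Matrix.mulVec_mulVec]

lemma mvL_one {n : ℕ} (x : E n) : mvL (1 : Matrix (Fin n) (Fin n) ℝ) x = x := by
  simp [mvL]

lemma mvL_add_smul {n : ℕ} (A B : Matrix (Fin n) (Fin n) ℝ) (c : ℝ) (x : E n) :
    mvL (A + c • B) x = mvL A x + c • mvL B x := by
  simp [mvL]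

lemma inner_mvL {m n : ℕ} (A : Matrix (Fin m) (Fin n) ℝ) (u : E n) (w : E m) :
    ⟪mvL A u, w⟫ = ⟪u, mvL Aᵀ w⟫ := by
  have := Matrix.toEuclideanLin_conjTranspose_eq_adjoint A
  rw [Matrix.conjTranspose_eq_transpose_of_trivial] at this
  simp only [mvL, LinearMap.coe_toContinuousLinearMap', this, LinearMap.adjoint_inner_right]

lemma inner_mvL_symm {n : ℕ} {A : Matrix (Fin n) (Fin n) ℝ} (hA : A.IsSymm) (u v : E n) :
    ⟪mvL A u, v⟫ = ⟪u, mvL A v⟫ := by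
  rw [inner_mvL, hA.eq]

lemma quad_eq {n : ℕ} (A : Matrix (Fin n) (Fin n) ℝ) (u : E n) : quad A u = ⟪mvL A u, u⟫ := by
  rw [quad, real_inner_comm]; rfl

lemma quad_nonneg {n : ℕ} {A : Matrix (Fin n) (Fin n) ℝ} (hA : A.PosSemidef) (u : E n) :
    0 ≤ ⟪mvL A u, u⟫ := by
  have := (Matrix.isPositive_toEuclideanLin_iff.2 hA).2 u
  simpa [mvL] using this

lemma isSymm_of_isHermitian {n : ℕ} {A : Matrix (Fin n) (Fin n) ℝ} (hA : A.IsHermitian) :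
    A.IsSymm := by
  have := hA.eq
  rwa [Matrix.conjTranspose_eq_transpose_of_trivial] at this

lemma mvL_inv {n : ℕ} {A : Matrix (Fin n) (Fin n) ℝ} (hA : A.PosDef) (u : E n) :
    mvL A (mvL A⁻¹ u) = u := by
  rw [← mvL_mul, Matrix.mul_nonsing_inv _ ((Matrix.isUnit_iff_isUnit_det _).1 hA.isUnit), mvL_one]

lemma mvL_inv' {n : ℕ} {A : Matrix (Fin n) (Fin n) ℝ} (hA : A.PosDef) (u : E n) :
    mvL A⁻¹ (mvL A u) = u := by
  rw [← mvL_mul, Matrix.nonsing_inv_mul _ ((Matrix.isUnit_iff_isUnit_det _).1 hA.isUnit), mvL_one]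

lemma isSymm_invSqrt {n : ℕ} (A : Matrix (Fin n) (Fin n) ℝ) : (invSqrt A).IsSymm :=
  isSymm_of_isHermitian (Matrix.nonneg_iff_posSemidef.1 (CFC.sqrt_nonneg A⁻¹)).isHermitian

lemma invSqrt_sq {n : ℕ} {A : Matrix (Fin n) (Fin n) ℝ} (hA : A.PosDef) (u : E n) :
    mvL (invSqrt A) (mvL (invSqrt A) u) = mvL A⁻¹ u := by
  rw [← mvL_mul, invSqrt,
    CFC.sqrt_mul_sqrt_self _ (Matrix.nonneg_iff_posSemidef.2 hA.inv.posSemidef)]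

lemma norm_invSqrt_sq {n : ℕ} {A : Matrix (Fin n) (Fin n) ℝ} (hA : A.PosDef) (u : E n) :
    ‖mvL (invSqrt A) u‖ ^ 2 = ⟪mvL A⁻¹ u, u⟫ := by
  rw [← real_inner_self_eq_norm_sq, ← inner_mvL_symm (isSymm_invSqrt A), invSqrt_sq hA]

lemma norm_invSqrt_mvL_sq {n : ℕ} {A : Matrix (Fin n) (Fin n) ℝ} (hA : A.PosDef) (u : E n) :
    ‖mvL (invSqrt A) (mvL A u)‖ ^ 2 = ⟪mvL A u, u⟫ := by
  rw [norm_invSqrt_sq hA, mvL_inv' hA, real_inner_comm]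

lemma invSqrt_invSqrt_mvL {n : ℕ} {A : Matrix (Fin n) (Fin n) ℝ} (hA : A.PosDef) (u : E n) :
    mvL (invSqrt A) (mvL (invSqrt A) (mvL A u)) = u := by
  rw [invSqrt_sq hA, mvL_inv' hA]

lemma exists_coercive {n : ℕ} {A : Matrix (Fin n) (Fin n) ℝ} (hA : A.PosDef) :
    ∃ α, 0 < α ∧ ∀ u : E n, α * ‖u‖ ^ 2 ≤ ⟪mvL A u, u⟫ := by
  -- From `u = A^{-1/2} (A^{-1/2} A u)`; the `+ 1` keeps the constant positive when `n = 0`.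
  refine ⟨(‖mvL (invSqrt A)‖ ^ 2 + 1)⁻¹, by positivity, fun u => ?_⟩
  rw [inv_mul_le_iff₀ (by positivity)]
  have h1 := pow_le_pow_left₀ (norm_nonneg _)
    ((mvL (invSqrt A)).le_opNorm (mvL (invSqrt A) (mvL A u))) 2
  rw [invSqrt_invSqrt_mvL hA, mul_pow, norm_invSqrt_mvL_sq hA] at h1
  linarith [quad_nonneg hA.posSemidef u]

/-- The operators of the theorem form a coupling with constant the squared norm of the
preconditioned matrix. -/
lemma exists_coupling {n m : ℕ} (K : Matrix (Fin m) (Fin n) ℝ) {S M₁ : Matrix (Fin n) (Fin n) ℝ}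
    {M₂ : Matrix (Fin m) (Fin m) ℝ} (hS : S.PosSemidef) (hM₁ : M₁.IsSymm)
    (hA : (M₁ + (1 / 2 : ℝ) • S).PosDef) (hB : M₂.PosDef) :
    ∃ α β, Coupling (mvL K) (mvL (M₂⁻¹ * K)) (mvL Kᵀ) (mvL M₁) (mvL S) (mvL M₂)
      (‖invSqrt M₂ * K * invSqrt (M₁ + (1 / 2 : ℝ) • S)‖ ^ 2) α β := by
  obtain ⟨α, hα, hα'⟩ := exists_coercive hA
  obtain ⟨β, hβ, hβ'⟩ := exists_coercive hB
  have hAe : ∀ u, ⟪mvL (M₁ + (1 / 2 : ℝ) • S) u, u⟫ = ⟪mvL M₁ u, u⟫ + 1 / 2 * ⟪mvL S u, u⟫ := by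
    intro u
    rw [mvL_add_smul, inner_add_left, real_inner_smul_left]
  refine ⟨α, β, ⟨inner_mvL K, inner_mvL_symm hM₁,
    inner_mvL_symm (isSymm_of_isHermitian hS.isHermitian),
    inner_mvL_symm (isSymm_of_isHermitian hB.isHermitian), fun u => ?_, quad_nonneg hS, hα, hβ,
    fun u => hAe u ▸ hα' u, hβ', sq_nonneg _, fun u => ?_⟩⟩
  · rw [mvL_mul, mvL_inv hB]
  -- `A^{-1/2} A u` plays the role of `A^{1/2} u`: the claim is the operator norm bound for the
  -- preconditioned matrix at this vector.
  · rw [← hAe, ← norm_invSqrt_mvL_sq hA, ← mul_pow, mvL_mul, real_inner_comm,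
      ← norm_invSqrt_sq hB, ← norm_mvL]
    refine pow_le_pow_left₀ (norm_nonneg _) ?_ 2
    have := (mvL (invSqrt M₂ * K * invSqrt (M₁ + (1 / 2 : ℝ) • S))).le_opNorm
      (mvL (invSqrt (M₁ + (1 / 2 : ℝ) • S)) (mvL (M₁ + (1 / 2 : ℝ) • S) u))
    rwa [mvL_mul, mvL_mul, invSqrt_invSqrt_mvL hA] at this

/-- The optimality conditions of the iteration. -/
lemma IsIteration.iterates {n m : ℕ} {K : Matrix (Fin m) (Fin n) ℝ} {f : E n → EReal}
    {g : E m → EReal} {M₁ : Matrix (Fin n) (Fin n) ℝ} {M₂ : Matrix (Fin m) (Fin m) ℝ}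
    {x : ℕ → E n} {y : ℕ → E m} (h : IsIteration K f g M₁ M₂ x y)
    (hf : ProperClosedConvex f) (hg : ProperClosedConvex (conj g))
    (hM₁ : M₁.IsSymm) (hM₂ : M₂.IsSymm) :
    Iterates (mvL K) (mvL Kᵀ) (mvL M₁) (mvL M₂) (subdiff f) (subdiff (conj g)) x y where
  primal k := by
    refine hf.subdiff_of_isMinOn (mvL M₁) (inner_mvL_symm hM₁) (mvL Kᵀ (y k)) (x k) (x (k + 1))
      fun z => ?_
    have := (isMinOn_univ_iff.1 (h k).1) z
    simp only [quad_eq, ← mvL_apply, inner_mvL K] at this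
    rwa [real_inner_comm z, real_inner_comm (x (k + 1)) (mvL Kᵀ (y k))]
  dual k := by
    have := hg.subdiff_of_isMinOn (mvL M₂) (inner_mvL_symm hM₂)
      (-mvL K ((2 : ℝ) • x (k + 1) - x k)) (y k) (y (k + 1)) fun z => by
        have := (isMinOn_univ_iff.1 (h k).2) z
        simpa only [quad_eq, ← mvL_apply, inner_neg_left] using this
    have e : (2 : ℝ) • x (k + 1) - x k = x (k + 1) + (x (k + 1) - x k) := by module
    rwa [neg_neg, e] at this

end Matrices

/-! ### Gap bound and step lengths for the matrix iteration -/

section Main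

lemma norm_le_cBar {n m : ℕ} {x : ℕ → E n} {y : ℕ → E m} {x' : E n} {y' : E m}
    (hx : Tendsto x atTop (𝓝 x')) (hy : Tendsto y atTop (𝓝 y')) (k : ℕ) :
    ‖x k - x'‖ + ‖y k - y'‖ ≤ cBar x y x' y' :=
  le_ciSup (f := fun k => ‖x k - x'‖ + ‖y k - y'‖)
    ((hx.sub_const x').norm.add (hy.sub_const y').norm).bddAbove_range k

/-- The primal-dual gap at an iterate of index at least one is bounded by the length of the
following step. -/
lemma exists_lagr_bound {n m : ℕ} {K : Matrix (Fin m) (Fin n) ℝ} {f : E n → EReal}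
    {g : E m → EReal} {M₁ : Matrix (Fin n) (Fin n) ℝ} {M₂ : Matrix (Fin m) (Fin m) ℝ}
    {x : ℕ → E n} {y : ℕ → E m} (hf : ProperClosedConvex f) (hg : ProperClosedConvex (conj g))
    (hit : Iterates (mvL K) (mvL Kᵀ) (mvL M₁) (mvL M₂) (subdiff f) (subdiff (conj g)) x y)
    {x' : E n} {y' : E m} (hx : Tendsto x atTop (𝓝 x')) (hy : Tendsto y atTop (𝓝 y')) :
    ∃ C, 0 ≤ C ∧ ∀ k, 1 ≤ k → ∀ u v, lagr K f g (x k) v - lagr K f g u (y k) ≤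
      ((C * (‖x (k + 1) - x k‖ + ‖y (k + 1) - y k‖) *
        (cBar x y x' y' + ‖x' - u‖ + ‖y' - v‖) : ℝ) : EReal) := by
  obtain ⟨C, hC0, hC⟩ := exists_gap_bound (M := mvL M₁) (B := mvL M₂) (inner_mvL K) hx hy
    (norm_le_cBar hx hy)
  refine ⟨C, hC0, fun k hk u v => ?_⟩
  -- The initial point need not lie in the domains; subgradients are available from index one on.
  -- Passing through iterate `k + 2` brings in the following step rather than the preceding one.
  obtain ⟨k, rfl⟩ := Nat.exists_eq_add_of_le' hk
  obtain ⟨r, hr, hr'⟩ := hf.subdiff_real (hit.primal k)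
  obtain ⟨r₂, hr₂, hr₂'⟩ := hf.subdiff_real (hit.primal (k + 1))
  obtain ⟨s, hs, hs'⟩ := hg.subdiff_real (hit.dual k)
  obtain ⟨s₂, hs₂, hs₂'⟩ := hg.subdiff_real (hit.dual (k + 1))
  refine lagr_sub_le hf hg hr hs (fun t ht => ?_) (fun t ht => ?_)
    (p := -⟪-mvL Kᵀ (y k) - mvL M₁ (x (k + 1) - x k), x (k + 2) - x (k + 1)⟫ +
      ⟪-mvL Kᵀ (y (k + 1)) - mvL M₁ (x (k + 2) - x (k + 1)), x (k + 2) - u⟫)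
    (q := -⟪mvL K (x (k + 1) + (x (k + 1) - x k)) - mvL M₂ (y (k + 1) - y k),
        y (k + 2) - y (k + 1)⟫ +
      ⟪mvL K (x (k + 2) + (x (k + 2) - x (k + 1))) - mvL M₂ (y (k + 2) - y (k + 1)),
        y (k + 2) - v⟫) ?_
  · have h1 := hr' (x (k + 2)) r₂ hr₂.le
    have h2 := hr₂' u t ht.le
    have e : x (k + 2) - u = -(u - x (k + 1 + 1)) := by abel
    rw [e, inner_neg_right]
    linarith
  · have h1 := hs' (y (k + 2)) s₂ hs₂.le
    have h2 := hs₂' v t ht.le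
    have e : y (k + 2) - v = -(v - y (k + 1 + 1)) := by abel
    rw [e, inner_neg_right]
    linarith
  · have := hC k u v
    simp only [← mvL_apply]
    linarith

/-- A weighted matrix norm controls the Euclidean norm, uniformly over the vectors that vanish if
the weight does. -/
lemma exists_norm_le_matNorm {n : ℕ} {A : Matrix (Fin n) (Fin n) ℝ} (hA : A.PosDef) {c : ℝ}
    (hc : 0 ≤ c) :
    ∃ C, 0 ≤ C ∧ ∀ u : E n, (c = 0 → u = 0) → ‖u‖ ≤ C * (c * matNorm A u) := by
  obtain ⟨α, hα, h⟩ := exists_coercive hA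
  refine ⟨(√α)⁻¹ * c⁻¹, by positivity, fun u hu => ?_⟩
  rcases hc.eq_or_lt with h0 | hpos
  · simp [hu h0.symm, ← h0]
  · rw [mul_assoc, inv_mul_cancel_left₀ hpos.ne', le_inv_mul_iff₀ (Real.sqrt_pos.2 hα), matNorm]
    refine Real.le_sqrt_of_sq_le ?_
    rw [mul_pow, Real.sq_sqrt hα.le, quad_eq]
    exact h u

lemma matNorm_sq_le {n : ℕ} {A : Matrix (Fin n) (Fin n) ℝ} (hA : A.PosDef) (u : E n) :
    matNorm A u ^ 2 ≤ ‖A‖ * ‖u‖ ^ 2 := by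
  rw [matNorm, quad_eq, Real.sq_sqrt (quad_nonneg hA.posSemidef u), ← norm_mvL, sq, ← mul_assoc]
  exact (real_inner_le_norm _ _).trans
    (mul_le_mul_of_nonneg_right ((mvL A).le_opNorm u) (norm_nonneg _))

lemma c₁_nonneg {n m : ℕ} (K : Matrix (Fin m) (Fin n) ℝ) (M₁ : Matrix (Fin n) (Fin n) ℝ) :
    0 ≤ c₁ K M₁ := add_nonneg (norm_nonneg _) (norm_nonneg _)

lemma c₂_nonneg {n m : ℕ} (K : Matrix (Fin m) (Fin n) ℝ) (M₂ : Matrix (Fin m) (Fin m) ℝ) :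
    0 ≤ c₂ K M₂ :=
  add_nonneg (div_nonneg (norm_nonneg _) (Real.sqrt_nonneg _)) (Real.sqrt_nonneg _)

lemma stepLength_nonneg {n m : ℕ} (K : Matrix (Fin m) (Fin n) ℝ)
    (M₁ S : Matrix (Fin n) (Fin n) ℝ) (M₂ : Matrix (Fin m) (Fin m) ℝ)
    (x : ℕ → E n) (y : ℕ → E m) (k : ℕ) : 0 ≤ stepLength K M₁ S M₂ x y k :=
  add_nonneg (mul_nonneg (c₁_nonneg K M₁) (Real.sqrt_nonneg _))
    (mul_nonneg (c₂_nonneg K M₂) (Real.sqrt_nonneg _))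

/-- The weighted step length controls the step, from the first iterate on. -/
lemma exists_step_le_stepLength {n m : ℕ} {K : Matrix (Fin m) (Fin n) ℝ} {f : E n → EReal}
    {G : E m → Set (E m)} {M₁ S : Matrix (Fin n) (Fin n) ℝ} {M₂ : Matrix (Fin m) (Fin m) ℝ}
    {x : ℕ → E n} {y : ℕ → E m}
    (hF : MonoWith (mvL S) (subdiff f))
    (hit : Iterates (mvL K) (mvL Kᵀ) (mvL M₁) (mvL M₂) (subdiff f) G x y)
    (hA : (M₁ + (1 / 2 : ℝ) • S).PosDef) (hB : M₂.PosDef) :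
    ∃ C, 0 ≤ C ∧ ∀ k, 1 ≤ k →
      ‖x (k + 1) - x k‖ + ‖y (k + 1) - y k‖ ≤ C * stepLength K M₁ S M₂ x y k := by
  obtain ⟨C₁, hC₁, h₁⟩ := exists_norm_le_matNorm hA (c₁_nonneg K M₁)
  obtain ⟨C₂, hC₂, h₂⟩ := exists_norm_le_matNorm hB (c₂_nonneg K M₂)
  refine ⟨C₁ + C₂, by positivity, fun k hk => ?_⟩
  obtain ⟨k, rfl⟩ := Nat.exists_eq_add_of_le' hk
  -- If `c₁ = 0`, then `K = 0` and `M₁ = 0`, so zero is a subgradient at both iterates; `S / 2` is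
  -- positive definite, hence they coincide.
  have ha := h₁ (x (k + 1 + 1) - x (k + 1)) fun h0 => by
    have hK : ‖K‖ = 0 := by
      unfold c₁ at h0; linarith [norm_nonneg K, norm_nonneg M₁]
    have hM : ‖M₁‖ = 0 := by
      unfold c₁ at h0; linarith [norm_nonneg K, norm_nonneg M₁]
    have hM0 := norm_eq_zero.1 hM
    have hK0 := norm_eq_zero.1 hK
    have hmono := hF _ _ _ _ (hit.primal (k + 1)) (hit.primal k)
    obtain ⟨α, hα, hco⟩ := exists_coercive hA
    have hco' := hco (x (k + 1 + 1) - x (k + 1))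
    have z₁ : ∀ w, mvL Kᵀ w = 0 := fun w => by rw [hK0]; simp [mvL]
    have z₂ : ∀ w, mvL M₁ w = 0 := fun w => by rw [hM0]; simp [mvL]
    rw [mvL_add_smul, z₂, zero_add, real_inner_smul_left] at hco'
    rw [z₁, z₁, z₂, z₂, sub_self, inner_zero_left] at hmono
    have h3 : α * ‖x (k + 1 + 1) - x (k + 1)‖ ^ 2 ≤ 0 := by linarith
    have h4 : ‖x (k + 1 + 1) - x (k + 1)‖ ^ 2 = 0 :=
      le_antisymm (nonpos_of_mul_nonpos_right h3 hα) (sq_nonneg _)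
    exact norm_eq_zero.1 (pow_eq_zero_iff two_ne_zero |>.1 h4)
  have hb := h₂ (y (k + 1 + 1) - y (k + 1)) fun h0 => by
    have h3 : √‖M₂‖ = 0 := by
      unfold c₂ at h0
      have := div_nonneg (norm_nonneg K) (Real.sqrt_nonneg (lambdaMin M₂))
      linarith [Real.sqrt_nonneg ‖M₂‖]
    have hM0 := norm_eq_zero.1 ((Real.sqrt_eq_zero (norm_nonneg M₂)).1 h3)
    rw [← mvL_inv' hB (y (k + 1 + 1) - y (k + 1)), hM0]
    simp [mvL]
  have p₁ := mul_nonneg (c₁_nonneg K M₁)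
    (Real.sqrt_nonneg (quad (M₁ + (1 / 2 : ℝ) • S) (x (k + 1 + 1) - x (k + 1))))
  have p₂ := mul_nonneg (c₂_nonneg K M₂) (Real.sqrt_nonneg (quad M₂ (y (k + 1 + 1) - y (k + 1))))
  unfold stepLength
  have p₃ := mul_nonneg hC₁ p₂
  have p₄ := mul_nonneg hC₂ p₁
  unfold matNorm at *
  linarith

lemma summable_stepLength_sq {n m : ℕ} (K : Matrix (Fin m) (Fin n) ℝ)
    {M₁ S : Matrix (Fin n) (Fin n) ℝ} {M₂ : Matrix (Fin m) (Fin m) ℝ}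
    {x : ℕ → E n} {y : ℕ → E m} (hA : (M₁ + (1 / 2 : ℝ) • S).PosDef) (hB : M₂.PosDef)
    (hx : Summable fun k => ‖x (k + 1) - x k‖ ^ 2)
    (hy : Summable fun k => ‖y (k + 1) - y k‖ ^ 2) :
    Summable fun k => stepLength K M₁ S M₂ x y k ^ 2 := by
  refine Summable.of_nonneg_of_le (fun k => sq_nonneg _) (fun k => ?_)
    ((hx.mul_left (2 * c₁ K M₁ ^ 2 * ‖M₁ + (1 / 2 : ℝ) • S‖)).add
      (hy.mul_left (2 * c₂ K M₂ ^ 2 * ‖M₂‖)))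
  unfold stepLength
  have h1 := mul_le_mul_of_nonneg_left (matNorm_sq_le hA (x (k + 1) - x k)) (sq_nonneg (c₁ K M₁))
  have h2 := mul_le_mul_of_nonneg_left (matNorm_sq_le hB (y (k + 1) - y k)) (sq_nonneg (c₂ K M₂))
  nlinarith [sq_nonneg (c₁ K M₁ * matNorm (M₁ + (1 / 2 : ℝ) • S) (x (k + 1) - x k) -
    c₂ K M₂ * matNorm M₂ (y (k + 1) - y k))]

/-- The smallest weighted step length among the indices `1, …, t` is `o(1/√t)`. -/
lemma exists_rate_bestIndex {n m : ℕ} {K : Matrix (Fin m) (Fin n) ℝ}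
    {M₁ S : Matrix (Fin n) (Fin n) ℝ} {M₂ : Matrix (Fin m) (Fin m) ℝ}
    {x : ℕ → E n} {y : ℕ → E m} (h : Summable fun k => stepLength K M₁ S M₂ x y k ^ 2) :
    ∃ μ : ℕ → ℝ, IsLittleOInvSqrt μ ∧ ∀ t, 1 ≤ t → ∀ k, IsBestIndex K M₁ S M₂ x y t k →
      stepLength K M₁ S M₂ x y k ≤ μ t := by
  have hex : ∀ t, ∃ k, 1 ≤ t → IsBestIndex K M₁ S M₂ x y t k := fun t => by
    by_cases ht : 1 ≤ t
    · obtain ⟨k, hk, hk'⟩ := Finset.exists_min_image (Finset.Icc 1 t)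
        (stepLength K M₁ S M₂ x y) ⟨1, Finset.mem_Icc.2 ⟨le_rfl, ht⟩⟩
      exact ⟨k, fun _ => ⟨hk, hk'⟩⟩
    · exact ⟨0, fun h => absurd h ht⟩
  -- Any two minimizers give the same length, so one choice yields a rate valid for all of them.
  choose κ hκ using hex
  refine ⟨fun t => stepLength K M₁ S M₂ x y (κ t),
    isLittleOInvSqrt_of_le_summable (fun k => sq_nonneg _) h
      (fun t => stepLength_nonneg K M₁ S M₂ x y _) fun t j hj hjt => ?_,
    fun t ht k hk => hk.2 _ (hκ t ht).1⟩
  exact pow_le_pow_left₀ (stepLength_nonneg K M₁ S M₂ x y _)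
    ((hκ t (hj.trans hjt)).2 j (Finset.mem_Icc.2 ⟨hj, hjt⟩)) 2

lemma FourThirdsCondition.of_normLtOne {n m : ℕ} {K : Matrix (Fin m) (Fin n) ℝ}
    {M₁ S : Matrix (Fin n) (Fin n) ℝ} {M₂ : Matrix (Fin m) (Fin m) ℝ}
    (h : NormLtOneCondition K M₁ S M₂) : FourThirdsCondition K M₁ S M₂ := by
  refine ⟨h.1, h.2.1, ?_⟩
  nlinarith [h.2.2, norm_nonneg (invSqrt M₂ * K * invSqrt (M₁ + (1 / 2 : ℝ) • S))]

end Main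

end PrePDHG

open PrePDHG in
theorem lemma3p5 {n m : ℕ} (K : Matrix (Fin m) (Fin n) ℝ)
    (f : E n → EReal) (g : E m → EReal)
    (hf : ProperClosedConvex f) (hg : ProperClosedConvex g)
    (hsaddle : ∃ xs ys, IsSaddlePoint K f g xs ys)
    (S : Matrix (Fin n) (Fin n) ℝ) (hS : IsMonotonicityMatrix f S)
    (M₁ : Matrix (Fin n) (Fin n) ℝ) (M₂ : Matrix (Fin m) (Fin m) ℝ)
    (hM₁ : M₁.IsSymm) (hM₂ : M₂.IsSymm)
    (x : ℕ → E n) (y : ℕ → E m) (hxy : IsIteration K f g M₁ M₂ x y) :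
    (FourThirdsCondition K M₁ S M₂ →
      ∃ (xInf : E n) (yInf : E m),
        Tendsto x atTop (𝓝 xInf) ∧ Tendsto y atTop (𝓝 yInf) ∧ IsSaddlePoint K f g xInf yInf ∧
        (∃ ε : ℕ → ℝ, IsLittleOInvSqrt ε ∧
          ∀ t, 1 ≤ t → ∀ k, IsBestIndex K M₁ S M₂ x y t k → ∀ (u : E n) (v : E m),
            lagr K f g (x k) v - lagr K f g u (y k) ≤
              ((ε t * (cBar x y xInf yInf + ‖xInf - u‖ + ‖yInf - v‖) : ℝ) : EReal)) ∧
        (∃ ε : ℕ → ℝ, IsLittleOInvSqrt ε ∧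
          ∀ t, 1 ≤ t → ∀ k, IsBestIndex K M₁ S M₂ x y t k →
            lagr K f g (x k) yInf - lagr K f g xInf (y k) ≤ ((ε t : ℝ) : EReal))) ∧
    (NormLtOneCondition K M₁ S M₂ →
      ∃ (xInf : E n) (yInf : E m),
        Tendsto x atTop (𝓝 xInf) ∧ Tendsto y atTop (𝓝 yInf) ∧ IsSaddlePoint K f g xInf yInf ∧
        (∃ ε : ℕ → ℝ, IsLittleOInvSqrt ε ∧
          ∀ t, 1 ≤ t → ∀ (u : E n) (v : E m),
            lagr K f g (x t) v - lagr K f g u (y t) ≤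
              ((ε t * (cBar x y xInf yInf + ‖xInf - u‖ + ‖yInf - v‖) : ℝ) : EReal)) ∧
        (∃ ε : ℕ → ℝ, IsLittleOInvSqrt ε ∧
          ∀ t, 1 ≤ t →
            lagr K f g (x t) yInf - lagr K f g xInf (y t) ≤ ((ε t : ℝ) : EReal))) := by
  have hg' := hg.conj
  have hit := hxy.iterates hf hg' hM₁ hM₂
  have hF : MonoWith (mvL S) (subdiff f) := fun x₁ x₂ ξ₁ ξ₂ h₁ h₂ => by
    rw [← quad_eq]; exact hS.2 x₁ x₂ ξ₁ ξ₂ h₁ h₂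
  have hG := hg'.monotone_subdiff
  have hiff := fun (xs : E n) (ys : E m) =>
    isSaddlePoint_iff_isKKT (K := K) (xs := xs) (ys := ys) hf hg' (mvL_apply K) (inner_mvL K)
  obtain ⟨xs, ys, hs⟩ := hsaddle
  rw [hiff] at hs
  have hconv : FourThirdsCondition K M₁ S M₂ → ∃ x' y', Tendsto x atTop (𝓝 x') ∧
      Tendsto y atTop (𝓝 y') ∧ IsSaddlePoint K f g x' y' := fun hc => by
    obtain ⟨α, β, hcoup⟩ := exists_coupling K hS.1 hM₁ hc.1 hc.2.1
    obtain ⟨x', y', hx, hy, h⟩ := exists_tendsto_isKKT hcoup hc.2.2 hF hG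
      hf.closedGraph_subdiff hg'.closedGraph_subdiff hit ⟨xs, ys, hs⟩
    exact ⟨x', y', hx, hy, (hiff x' y').2 h⟩
  have hle : ∀ {a b c : ℝ} {D : ℝ}, 0 ≤ c → 0 ≤ D → a ≤ b →
      ((c * a * D : ℝ) : EReal) ≤ ((c * b * D : ℝ) : EReal) := fun hc hD hab =>
    EReal.coe_le_coe_iff.2 (mul_le_mul_of_nonneg_right (mul_le_mul_of_nonneg_left hab hc) hD)
  constructor
  · intro hc
    obtain ⟨x', y', hx, hy, hsp⟩ := hconv hc
    obtain ⟨C, hC0, hC⟩ := exists_lagr_bound hf hg' hit hx hy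
    obtain ⟨C', hC0', hC'⟩ := exists_step_le_stepLength hF hit hc.1 hc.2.1
    obtain ⟨α, β, hcoup⟩ := exists_coupling K hS.1 hM₁ hc.1 hc.2.1
    obtain ⟨hsa, hsb⟩ := summable_steps hcoup hc.2.2 hF hG hit hs
    obtain ⟨μ, hμ, hμ'⟩ :=
      exists_rate_bestIndex (summable_stepLength_sq K hc.1 hc.2.1 hsa hsb)
    have hcb : 0 ≤ cBar x y x' y' :=
      (add_nonneg (norm_nonneg _) (norm_nonneg _)).trans (norm_le_cBar hx hy 0)
    have hmain : ∀ t, 1 ≤ t → ∀ k, IsBestIndex K M₁ S M₂ x y t k → ∀ (u : E n) (v : E m),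
        lagr K f g (x k) v - lagr K f g u (y k) ≤
          ((C * (C' * μ t) * (cBar x y x' y' + ‖x' - u‖ + ‖y' - v‖) : ℝ) : EReal) :=
      fun t ht k hk u v => (hC k (Finset.mem_Icc.1 hk.1).1 u v).trans (hle hC0 (by positivity)
        ((hC' k (Finset.mem_Icc.1 hk.1).1).trans (mul_le_mul_of_nonneg_left (hμ' t ht k hk) hC0')))
    have hlo : IsLittleOInvSqrt fun t => C * (C' * μ t) := (hμ.const_mul_left C').const_mul_left C
    refine ⟨x', y', hx, hy, hsp, ⟨_, hlo, hmain⟩,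
      -- At the limit point the distance factor reduces to `cBar`, a constant.
      ⟨fun t => cBar x y x' y' * (C * (C' * μ t)), hlo.const_mul_left _, fun t ht k hk => ?_⟩⟩
    have := hmain t ht k hk x' y'
    rwa [sub_self, sub_self, norm_zero, norm_zero, add_zero, add_zero, mul_comm] at this
  · intro hc
    have hc' := FourThirdsCondition.of_normLtOne hc
    obtain ⟨x', y', hx, hy, hsp⟩ := hconv hc'
    obtain ⟨C, hC0, hC⟩ := exists_lagr_bound hf hg' hit hx hy
    obtain ⟨α, β, hcoup⟩ := exists_coupling K hS.1 hM₁ hc.1 hc.2.1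
    obtain ⟨μ, hμ, hμ'⟩ := exists_rate_of_lt_one hcoup
      (pow_lt_one₀ (norm_nonneg _) hc.2.2 two_ne_zero) hF hG hit hs
    have hcb : 0 ≤ cBar x y x' y' :=
      (add_nonneg (norm_nonneg _) (norm_nonneg _)).trans (norm_le_cBar hx hy 0)
    have hmain : ∀ t, 1 ≤ t → ∀ (u : E n) (v : E m),
        lagr K f g (x t) v - lagr K f g u (y t) ≤
          ((C * μ t * (cBar x y x' y' + ‖x' - u‖ + ‖y' - v‖) : ℝ) : EReal) :=
      fun t ht u v => (hC t ht u v).trans (hle hC0 (by positivity) (hμ' t))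
    have hlo : IsLittleOInvSqrt fun t => C * μ t := hμ.const_mul_left C
    refine ⟨x', y', hx, hy, hsp, ⟨_, hlo, hmain⟩,
      ⟨fun t => cBar x y x' y' * (C * μ t), hlo.const_mul_left _, fun t ht => ?_⟩⟩
    have := hmain t ht x' y'
    rwa [sub_self, sub_self, norm_zero, norm_zero, add_zero, add_zero, mul_comm] at this
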